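/- Let $(\mathbb X,\mathcal X)$ be a measurable space with a $\sigma$-finite measure $\lambda$ (atoms are allowed), and let $\eta$ be a Poisson process on $\mathbb X$ with intensity measure $\lambda$, i.e. a random element of the space of $\sigma$-finite measures on $\mathbb X$ with values in $\{0,1,2,\dots\}\cup\{\infty\}$ (with the $\sigma$-field generated by the maps $\mu\mapsto\mu(B)$, $B\in\mathcal X$) such that $\eta(B)$ is Poisson distributed with parameter $\lambda(B)$ for each $B\in\mathcal X$ (with $\eta(B)=\infty$ a.s. if $\lambda(B)=\infty$) and $\eta(B_1),\dots,\eta(B_k)$ are independent for pairwise disjoint $B_1,\dots,B_k\in\mathcal X$. For an integer-valued $\sigma$-finite measure $\mu$ let $\mu^{(m)}$ be its $m$-th factorial measure on $\mathbb X^m$, given by $\mu^{(1)}=\mu$ and $\mu^{(m+1)}(d(x_1,\dots,x_{m+1}))=\big(\mu-\sum_{j=1}^m\delta_{x_j}\big)(dx_{m+1})\,\mu^{(m)}(d(x_1,\dots,x_m))$. Let $L^1_s(\lambda^n)$ be the set of all measurable, symmetric, $\lambda^n$-integrable functions $f:\mathbb X^n\to\mathbb R$. For $n\ge 1$ and $f\in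 L^1_s(\lambda^n)$ the pathwise multiple Wiener–Itô integral is $$I_n(f)=\sum_{J\subset[n]}(-1)^{n-|J|}\iint f(x_1,\dots,x_n)\,\eta^{(|J|)}(dx_J)\,\lambda^{n-|J|}(dx_{J^c}),$$ where $[n]=\{1,\dots,n\}$, $x_J=(x_j)_{j\in J}$, $J^c=[n]\setminus J$ (for $J=\emptyset$ the inner integral is $f(x_1,\dots,x_n)$). Let $\ell,n_1,\dots,n_\ell\ge 1$ be integers, $n=n_1+\dots+n_\ell$, and $J_i=\{j:n_1+\dots+n_{i-1}<j\le n_1+\dots+n_i\}$ for $i=1,\dots,\ell$. Let $\Pi(n_1,\dots,n_\ell)$ be the set of all (non-flat) partitions $\sigma$ of $[n]$ each of whose blocks meets every $J_i$ in at most one element, and let $\Pi_{\ge2}(n_1,\dots,n_\ell)$ be the set of those $\sigma\in\Pi(n_1,\dots,n_\ell)$ all of whose blocks have at least two elements. For such $\sigma$ let $\sigma^*$ be the finest partition of $[\ell]$ such that $i$ and $j$ lie in the same block of $\sigma^*$ whenever $J_i$ and $J_j$ are both intersected by the same block of $\sigma$; let $\tilde\Pi_{\ge2}(n_1,\dots,n_\ell)$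 be the set of all $\sigma\in\Pi_{\ge2}(n_1,\dots,n_\ell)$ such that $\sigma^*$ has exactly one block. For $f_i:\mathbb X^{n_i}\to\mathbb R$ put $(\otimes_{i=1}^\ell f_i)(x_1,\dots,x_n)=\prod_{i=1}^\ell f_i(x_{J_i})$, and for $F:\mathbb X^n\to\mathbb R$ and a partition $\sigma$ of $[n]$ with $|\sigma|$ blocks let $F_\sigma:\mathbb X^{|\sigma|}\to\mathbb R$ be the function obtained from $F$ by identifying the arguments belonging to the same block of $\sigma$. The joint cumulant of random variables $X_1,\dots,X_\ell$ is $$\gamma(X_1,\dots,X_\ell)=(-\mathbf i)^\ell\frac{\partial^\ell}{\partial z_1\cdots\partial z_\ell}\log\mathbb E\exp\big[\mathbf i(z_1X_1+\dots+z_\ell X_\ell)\big]\Big|_{z_1=\dots=z_\ell=0}.$$ **Theorem.** Let $f_i\in L^1_s(\lambda^{n_i})$, $i=1,\dots,\ell$, and assume that $$\int(\otimes_{i=1}^\ell|f_i|)_\sigma\,d\lambda^{|\sigma|}<\infty\qquad\text{for all }\sigma\in\Pi(n_1,\dots,n_\ell).$$ Then $\prod_{i=1}^\ell I_{n_i}(f_i)$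 is integrable and $$\mathbb E\prod_{i=1}^\ell I_{n_i}(f_i)=\sum_{\sigma\in\Pi_{\ge2}(n_1,\dots,n_\ell)}\int(\otimes_{i=1}^\ell f_i)_\sigma\,d\lambda^{|\sigma|}.$$ Moreover $$\gamma\big(I_{n_1}(f_1),\dots,I_{n_\ell}(f_\ell)\big)=\sum_{\sigma\in\tilde\Pi_{\ge2}(n_1,\dots,n_\ell)}\int(\otimes_{i=1}^\ell f_i)_\sigma\,d\lambda^{|\sigma|}.$$ If no $f_i$ vanishes $\lambda^{n_i}$-almost everywhere, then $\prod_{i\in S}I_{n_i}(f_i)$ is integrable for every $S\subset[\ell]$, so that this joint cumulant is well defined. If some $f_i$ vanishes $\lambda^{n_i}$-almost everywhere, then $I_{n_i}(f_i)=0$ almost surely, the joint cumulant is understood to be $0$, and the cumulant formula reads $0=0$. -/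

import Mathlib

open MeasureTheory ProbabilityTheory
open scoped ENNReal NNReal

namespace PoissonChaos

/-- The Poisson distribution on `[0, ∞]` with parameter `c ∈ [0, ∞]`; for `c = ∞` it is the point
mass at `∞`. -/
noncomputable def poissonLaw (c : ℝ≥0∞) : Measure ℝ≥0∞ :=
  if c = ∞ then Measure.dirac ∞
  else (poissonMeasure c.toNNReal).map (fun k : ℕ => (k : ℝ≥0∞))

/-- `η` is a Poisson process with intensity measure `lam`: a random element of the space of
`σ`-finite measures with values in `{0, 1, 2, …} ∪ {∞}` (with the `σ`-field generated by the
evaluations `μ ↦ μ B`) such that `η(B)` is Poisson distributed with parameter `lam B`, and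
`η(B₁), …, η(B_k)` are independent for pairwise disjoint measurable `B₁, …, B_k`. -/
structure IsPoissonProcess {Ω X : Type*} [MeasurableSpace Ω] [MeasurableSpace X]
    (η : Ω → Measure X) (lam : Measure X) (P : Measure Ω) : Prop where
  measurable : Measurable η
  sigmaFinite : ∀ ω, SigmaFinite (η ω)
  integerValued : ∀ ω (B : Set X), MeasurableSet B → ∃ k : ℕ∞, η ω B = (k : ℝ≥0∞)
  map_eq : ∀ B : Set X, MeasurableSet B → P.map (fun ω => η ω B) = poissonLaw (lam B)
  indep : ∀ (k : ℕ) (B : Fin k → Set X), (∀ i, MeasurableSet (B i)) →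
    Pairwise (fun i j => Disjoint (B i) (B j)) → iIndepFun (fun i ω => η ω (B i)) P

/-- The factorial measure `μ^{(m)}` on `X^m` of an integer-valued `σ`-finite measure `μ`:
`μ^{(m+1)}(B) = ∫ (∫ 1_B(x, y) μ(dy) - ∑_{j} 1_B(x, x_j)) μ^{(m)}(dx)`, that is,
`μ^{(m+1)}(d(x, y)) = (μ - ∑_{j} δ_{x_j})(dy) μ^{(m)}(dx)`.
The subtracted measure is `σ`-finite and is dominated by the product measure, so that the
subtraction of measures is the setwise one (on sets of finite measure). -/
noncomputable def factorialMeasure {X : Type*} [MeasurableSpace X] (μ : Measure X) :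
    (m : ℕ) → Measure (Fin m → X)
  | 0 => Measure.dirac (fun i => i.elim0)
  | m + 1 =>
      ((factorialMeasure μ m).prod μ).map
          (fun p : (Fin m → X) × X => (Fin.snoc p.1 p.2 : Fin (m + 1) → X))
        - ∑ j : Fin m,
          (factorialMeasure μ m).map (fun x : Fin m → X => (Fin.snoc x (x j) : Fin (m + 1) → X))

/-- `f ∈ L¹_s(lam^n)`: `f` is measurable, symmetric and integrable with respect to `lam^n`. -/
structure IsL1Symm {X : Type*} [MeasurableSpace X] (lam : Measure X) {n : ℕ}
    (f : (Fin n → X) → ℝ) : Prop where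
  measurable : Measurable f
  symmetric : ∀ (π : Equiv.Perm (Fin n)) (x : Fin n → X), f (fun i => x (π i)) = f x
  integrable : Integrable f (Measure.pi fun _ : Fin n => lam)

/-- The point of `X^n` with coordinates `x` in `J` (inserted in increasing order) and coordinates
`y` in the complement of `J`. -/
noncomputable def mergePoint {X : Type*} {n : ℕ} (J : Finset (Fin n)) (x : Fin J.card → X)
    (y : {j : Fin n // j ∉ J} → X) : Fin n → X :=
  fun j => if h : j ∈ J then x ((J.orderIsoOfFin rfl).symm ⟨j, h⟩) else y ⟨j, h⟩

/-- The pathwise multiple Wiener–Itô integral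
`I_n(f) = ∑_{J ⊆ [n]} (-1)^{n-|J|} ∫∫ f(x) μ^{(|J|)}(dx_J) lam^{n-|J|}(dx_{J^c})`,
evaluated at the realization `μ` of the Poisson process. -/
noncomputable def wienerIto {X : Type*} [MeasurableSpace X] (lam : Measure X) {n : ℕ}
    (f : (Fin n → X) → ℝ) (μ : Measure X) : ℝ :=
  ∑ J : Finset (Fin n), (-1 : ℝ) ^ (n - J.card) *
    ∫ y : {j : Fin n // j ∉ J} → X, (∫ x : Fin J.card → X, f (mergePoint J x y)
      ∂(factorialMeasure μ J.card)) ∂(Measure.pi fun _ : {j : Fin n // j ∉ J} => lam)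

/-! ### Diagrams

The index set `[n₁ + … + n_ℓ]` is written as the disjoint union `Σ i, Fin (n i)` of its rows
`J_i = {i} × [n_i]`. -/

/-- Partitions of the disjoint union of the rows. -/
abbrev RowPartition {ℓ : ℕ} (n : Fin ℓ → ℕ) : Type :=
  Finpartition (Finset.univ : Finset (Σ i : Fin ℓ, Fin (n i)))

/-- `σ ∈ Π(n₁, …, n_ℓ)`: every block meets every row in at most one element. -/
def IsNonFlat {ℓ : ℕ} {n : Fin ℓ → ℕ} (σ : RowPartition n) : Prop :=
  ∀ B ∈ σ.parts, ∀ i : Fin ℓ, (B.filter fun p => p.1 = i).card ≤ 1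

/-- `σ ∈ Π_{≥2}(n₁, …, n_ℓ)`. -/
def IsNonFlatTwo {ℓ : ℕ} {n : Fin ℓ → ℕ} (σ : RowPartition n) : Prop :=
  IsNonFlat σ ∧ ∀ B ∈ σ.parts, 2 ≤ B.card

/-- The partition `σ*` of `[ℓ]`, as an equivalence relation: the finest one such that `i` and `j`
are equivalent whenever the rows `i` and `j` are both intersected by the same block of `σ`. -/
def rowSetoid {ℓ : ℕ} {n : Fin ℓ → ℕ} (σ : RowPartition n) : Setoid (Fin ℓ) :=
  sInf {r | ∀ B ∈ σ.parts, ∀ p ∈ B, ∀ q ∈ B, r p.1 q.1}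

/-- `σ ∈ Π̃_{≥2}(n₁, …, n_ℓ)`: moreover `σ*` has exactly one block. -/
def IsConnectedNonFlatTwo {ℓ : ℕ} {n : Fin ℓ → ℕ} (σ : RowPartition n) : Prop :=
  IsNonFlatTwo σ ∧ (rowSetoid σ).classes.ncard = 1

/-- The tensor product `⊗ f_i`. -/
def tensor {X : Type*} {ℓ : ℕ} {n : Fin ℓ → ℕ} (f : ∀ i, (Fin (n i) → X) → ℝ)
    (x : (Σ i : Fin ℓ, Fin (n i)) → X) : ℝ :=
  ∏ i, f i (fun k => x ⟨i, k⟩)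

/-- `F_σ`: identify the arguments of `F` that belong to the same block of `σ`. The arguments of
`F_σ` are indexed by the blocks of `σ`. -/
def collapse {X : Type*} {ℓ : ℕ} {n : Fin ℓ → ℕ} (σ : RowPartition n)
    (F : ((Σ i : Fin ℓ, Fin (n i)) → X) → ℝ) (y : {B // B ∈ σ.parts} → X) : ℝ :=
  F (fun p => y ⟨σ.part p, σ.part_mem.2 (Finset.mem_univ p)⟩)

/-- The measure `lam^{|σ|}`, with coordinates indexed by the blocks of `σ`. -/
noncomputable def blockMeasure {X : Type*} [MeasurableSpace X] (lam : Measure X) {ℓ : ℕ}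
    {n : Fin ℓ → ℕ} (σ : RowPartition n) : Measure ({B // B ∈ σ.parts} → X) :=
  Measure.pi fun _ => lam

/-! ### Joint cumulants -/

/-- The joint characteristic function `z ↦ E exp(i (z₁ X₁ + … + z_ℓ X_ℓ))`. -/
noncomputable def jointCharFun {Ω : Type*} [MeasurableSpace Ω] (P : Measure Ω) {ℓ : ℕ}
    (Y : Fin ℓ → Ω → ℝ) (z : Fin ℓ → ℝ) : ℂ :=
  ∫ ω, Complex.exp (Complex.I * ((∑ j, z j * Y j ω : ℝ) : ℂ)) ∂P

/-- The partial derivative `∂F/∂z_j`. -/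
noncomputable def partialDeriv {ℓ : ℕ} (j : Fin ℓ) (F : (Fin ℓ → ℝ) → ℂ) (z : Fin ℓ → ℝ) : ℂ :=
  deriv (fun t : ℝ => F (Function.update z j t)) (z j)

/-- The joint cumulant
`(-i)^ℓ ∂^ℓ/(∂z₁ ⋯ ∂z_ℓ) log E exp(i (z₁ X₁ + … + z_ℓ X_ℓ))` at `z = 0`. -/
noncomputable def jointCumulant {Ω : Type*} [MeasurableSpace Ω] (P : Measure Ω) {ℓ : ℕ}
    (Y : Fin ℓ → Ω → ℝ) : ℂ :=
  (-Complex.I) ^ ℓ *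
    ((List.finRange ℓ).foldr partialDeriv (fun z => Complex.log (jointCharFun P Y z))) 0

end PoissonChaos

/-!
An integer-valued `σ`-finite measure `μ` is a countable sum of zero-one measures
(`exists_sum_isZeroOne`). On a general measurable space these take the place of Dirac measures: they
are idempotent in the sense that identifying or repeating coordinates of a product of zero-one
measures gives a product measure again (`map_comp_pi`). Hence the factorial measure `μ^{(m)}` is
the sum, over all `m`-tuples of distinct summands, of the product measures
(`factorialMeasure_sum`), and no regularity of the space is needed. The measures
`lam^{Jᶜ} ⊗ μ^{(|J|)}` in the definition of the multiple integral have the same shape; they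
are the mixed factorial measures.

*Moments.* On boxes whose sides are pairwise equal or disjoint, a mixed factorial measure is a product
of falling factorials of the counts of disjoint sets. For a Poisson process these counts are
independent with known factorial moments, and such boxes form a generating `π`-system. So the
expectation of every mixed factorial measure is the power of the intensity measure
(`IsSplitPoisson.bind_mixedFactorial`). A product of mixed factorial measures is a sum of mixed
factorial measures over the ways to identify entries of different rows
(`pi_mixedFactorial`); taking expectations, a product of multiple integrals becomes a signed sum of
the integrals of non-flat diagrams. The alternating signs cancel every diagram with a one-element
block, because each such block may or may not be integrated against the intensity measure
(`sum_sign_compatible`). This gives the moment formula `IsSplitPoisson.integral_prod_splitIntegral`.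

*Cumulants.* For a fixed index `j`, the moments and the cumulants of subfamilies satisfy
`m S = ∑ κ T * m (S \ T)`, the sum running over `j ∈ T ⊆ S`. The recursion determines `κ`, and it is
compatible with differentiation of the characteristic function, so that any solution computes the
joint cumulant (`jointCumulant_eq_of_recursion`). The sums over connected diagrams are a solution: a
diagram on the rows in `S` is the juxtaposition of the connected diagram on the component `T` of the
row `j` with an arbitrary diagram on `S \ T` (`diagramMoment_eq_sum`). The moment formula applies to
subfamilies since a diagram on a subfamily can be completed by one-element blocks on the other rows;
Fubini's theorem then shows that it is integrable if no function vanishes almost everywhere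
(`diagramIntegrable_of_glue`). If one does, its multiple integral is almost surely zero, the
characteristic function does not depend on the corresponding variable, and both sides of the cumulant
formula vanish.

Partitions of the set of cells are encoded as equivalence relations, with the quotient as the set of
blocks; `partitionSetoid_bijective` relates them to the partitions in the statement.
-/


namespace PoissonChaos

open Set

/-! ### Zero-one measures -/

/-- A probability measure taking only the values `0` and `1`: the substitute for a Dirac measure on
a measurable space whose points need not be measurable. -/
structure IsZeroOne {X : Type*} [MeasurableSpace X] (ν : Measure X) : Prop where
  prob : IsProbabilityMeasure ν
  zero_or_one : ∀ A, MeasurableSet A → ν A = 0 ∨ ν A = 1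

section ZeroOne

variable {X : Type*} [MeasurableSpace X]

theorem IsZeroOne.measure_inter {ν : Measure X} (h : IsZeroOne ν) {A B : Set X}
    (hA : MeasurableSet A) : ν (A ∩ B) = ν A * ν B := by
  have := h.prob
  rcases h.zero_or_one A hA with h0 | h1
  · rw [h0, zero_mul]
    exact measure_mono_null inter_subset_left h0
  · rw [h1, one_mul, inter_comm]
    exact measure_inter_conull ((prob_compl_eq_zero_iff hA).2 h1)

theorem IsZeroOne.measure_biInter {ν : Measure X} (h : IsZeroOne ν) {ι : Type*} (s : Finset ι)
    {A : ι → Set X} (hA : ∀ p, MeasurableSet (A p)) :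
    ν (⋂ p ∈ s, A p) = ∏ p ∈ s, ν (A p) := by
  classical
  have := h.prob
  induction s using Finset.induction_on with
  | empty => simp
  | insert p s hp ih =>
    rw [Finset.prod_insert hp, Finset.set_biInter_insert, h.measure_inter (hA p), ih]

/-- Reindexing the coordinates of a product measure along `g` gives again a product measure,
provided that a coordinate is repeated or omitted only if its factor is a zero-one measure. -/
theorem map_comp_pi {ι κ : Type*} [Fintype ι] [Fintype κ] (ρ : κ → Measure X)
    [∀ b, SigmaFinite (ρ b)] (g : ι → κ)
    (hg : ∀ b, IsZeroOne (ρ b) ∨ ∃ p, ∀ q, g q = b ↔ q = p) :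
    (Measure.pi ρ).map (fun y p => y (g p)) = Measure.pi (fun p => ρ (g p)) := by
  classical
  symm
  refine Measure.pi_eq fun A hA => ?_
  rw [Measure.map_apply (by fun_prop) (MeasurableSet.univ_pi hA)]
  have hpre : (fun (y : κ → X) (p : ι) => y (g p)) ⁻¹' (pi univ A) =
      pi univ (fun b => ⋂ p ∈ Finset.univ.filter (fun p => g p = b), A p) := by
    ext y
    simp only [mem_preimage, mem_pi, mem_univ, true_implies, Finset.mem_filter, Finset.mem_univ,
      true_and, mem_iInter]
    exact ⟨fun h b p hp => hp ▸ h p, fun h p => h (g p) p rfl⟩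
  rw [hpre, Measure.pi_pi, ← Finset.prod_fiberwise (s := Finset.univ) (g := g)]
  refine Finset.prod_congr rfl fun b _ => ?_
  have : ∏ p with g p = b, (ρ (g p)) (A p) = ∏ p with g p = b, (ρ b) (A p) :=
    Finset.prod_congr rfl fun p hp => by rw [(Finset.mem_filter.1 hp).2]
  rw [this]
  rcases hg b with h | ⟨p, hp⟩
  · exact h.measure_biInter _ hA
  · have : Finset.univ.filter (fun q => g q = b) = {p} := by
      ext q; simp [hp]
    rw [this]; simp

/-- A finite integer-valued measure is a finite sum of zero-one measures: a measure taking a value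
strictly between `0` and its total mass is split along the corresponding set. -/
theorem exists_list_sum_isZeroOne (N : ℕ) : ∀ μ : Measure X, μ univ = N →
    (∀ B, MeasurableSet B → ∃ k : ℕ∞, μ B = (k : ℝ≥0∞)) →
    ∃ L : List (Measure X), (∀ ν ∈ L, IsZeroOne ν) ∧ L.sum = μ := by
  induction N using Nat.strong_induction_on with
  | _ N ih =>
    intro μ hN hint
    have hnat : ∀ B, MeasurableSet B → ∃ k : ℕ, μ B = k := by
      intro B hB
      obtain ⟨k, hk⟩ := hint B hB
      have : μ B ≠ ∞ := ((measure_mono (subset_univ B)).trans_lt (hN ▸ ENNReal.natCast_lt_top N)).ne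
      induction k using ENat.recTopCoe with
      | top => simp [hk] at this
      | coe k => exact ⟨k, by simpa using hk⟩
    by_cases hs : ∃ A, MeasurableSet A ∧ μ A ≠ 0 ∧ μ A ≠ N
    · obtain ⟨A, hA, h0, h1⟩ := hs
      obtain ⟨a, ha⟩ := hnat A hA
      obtain ⟨b, hb⟩ := hnat Aᶜ hA.compl
      have hab : a + b = N := by
        have := measure_add_measure_compl (μ := μ) hA
        rw [ha, hb, hN] at this
        exact_mod_cast this
      have ha0 : a ≠ 0 := by rintro rfl; simp [ha] at h0
      have haN : a ≠ N := by rintro rfl; exact h1 ha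
      have hr : ∀ C, MeasurableSet C → ∀ B, MeasurableSet B →
          ∃ k : ℕ∞, μ.restrict C B = (k : ℝ≥0∞) := fun C hC B hB => by
        rw [Measure.restrict_apply hB]; exact hint _ (hB.inter hC)
      obtain ⟨L₁, h₁, e₁⟩ := ih a (by omega) (μ.restrict A) (by simpa using ha) (hr A hA)
      obtain ⟨L₂, h₂, e₂⟩ := ih b (by omega) (μ.restrict Aᶜ) (by simpa using hb) (hr _ hA.compl)
      refine ⟨L₁ ++ L₂, fun ν hν => ?_, ?_⟩
      · rcases List.mem_append.1 hν with h | h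
        exacts [h₁ ν h, h₂ ν h]
      · rw [List.sum_append, e₁, e₂, Measure.restrict_add_restrict_compl hA]
    · push Not at hs
      rcases Nat.eq_zero_or_pos N with rfl | hpos
      · exact ⟨[], by simp, by simpa using (Measure.measure_univ_eq_zero.1 (by simpa using hN)).symm⟩
      have hNne : (N : ℝ≥0∞) ≠ 0 := by exact_mod_cast hpos.ne'
      have hcancel : (N : ℝ≥0∞)⁻¹ * N = 1 :=
        ENNReal.inv_mul_cancel hNne (ENNReal.natCast_ne_top N)
      refine ⟨List.replicate N ((N : ℝ≥0∞)⁻¹ • μ), fun ν hν => ?_, ?_⟩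
      · rw [List.eq_of_mem_replicate hν]
        refine ⟨⟨by simp [hN, hcancel]⟩, fun A hA => ?_⟩
        by_cases h0 : μ A = 0
        · left; simp [h0]
        · right; simp [hs A hA h0, hcancel]
      · rw [List.sum_replicate]
        ext B _
        rw [← Nat.cast_smul_eq_nsmul ℝ≥0∞, smul_smul, mul_comm, hcancel, one_smul]

/-- A `σ`-finite integer-valued measure is a countable sum of zero-one measures. -/
theorem exists_sum_isZeroOne (μ : Measure X) [SigmaFinite μ]
    (hint : ∀ B, MeasurableSet B → ∃ k : ℕ∞, μ B = (k : ℝ≥0∞)) :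
    ∃ (E : Type) (_ : Countable E) (ν : E → Measure X), (∀ e, IsZeroOne (ν e)) ∧
      Measure.sum ν = μ := by
  have key : ∀ k, ∃ L : List (Measure X), (∀ ν ∈ L, IsZeroOne ν) ∧
      L.sum = μ.restrict (disjointed (spanningSets μ) k) := by
    intro k
    have hm : MeasurableSet (disjointed (spanningSets μ) k) :=
      MeasurableSet.disjointed (measurableSet_spanningSets μ) k
    have hfin : μ (disjointed (spanningSets μ) k) < ∞ :=
      (measure_mono (disjointed_subset _ _)).trans_lt (measure_spanningSets_lt_top μ k)
    obtain ⟨m, hm'⟩ := hint _ hm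
    induction m using ENat.recTopCoe with
    | top => simp [hm'] at hfin
    | coe m =>
      refine exists_list_sum_isZeroOne m _ (by simpa using hm') fun B hB => ?_
      rw [Measure.restrict_apply hB]
      exact hint _ (hB.inter hm)
  choose L hL hsum using key
  refine ⟨Σ k, Fin (L k).length, inferInstance, fun e => (L e.1)[e.2],
    fun e => hL e.1 _ (List.getElem_mem _), ?_⟩
  rw [← sum_restrict_disjointed_spanningSets μ μ]
  ext B hB
  rw [Measure.sum_apply _ hB, Measure.sum_apply _ hB, ENNReal.tsum_sigma']
  refine tsum_congr fun k => ?_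
  rw [← hsum k, ← Measure.sum_apply _ hB, Measure.sum_fintype]
  congr 1
  exact Fin.sum_univ_getElem (L k)

theorem Measure.add_sub_cancel_of_sigmaFinite (μ ν : Measure X) [SigmaFinite ν] :
    μ + ν - ν = μ := by
  refine le_antisymm (Measure.sub_le_of_le_add le_rfl) ?_
  rw [Measure.sub_def]
  refine le_sInf fun d hd => Measure.le_iff.2 fun s hs => ?_
  have hs' : s = ⋃ k, s ∩ spanningSets ν k := by
    rw [← inter_iUnion, iUnion_spanningSets, inter_univ]
  have hmono : Monotone fun k => s ∩ spanningSets ν k :=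
    fun i j hij => inter_subset_inter_right _ (monotone_spanningSets ν hij)
  rw [hs', hmono.measure_iUnion, hmono.measure_iUnion]
  refine iSup_mono fun k => ?_
  have h := Measure.le_iff.1 hd _ (hs.inter (measurableSet_spanningSets ν k))
  rw [Measure.add_apply, Measure.add_apply] at h
  refine (ENNReal.add_le_add_iff_right ?_).1 h
  exact ((measure_mono inter_subset_right).trans_lt (measure_spanningSets_lt_top ν k)).ne

/-! ### Sums of product measures -/

theorem finite_setOf_measure_ne_zero {E : Type*} {ν : E → Measure X} (hν : ∀ e, IsZeroOne (ν e))
    {D : Set X} (hD : MeasurableSet D) (h : Measure.sum ν D ≠ ∞) : {e | ν e D ≠ 0}.Finite := by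
  rw [Measure.sum_apply _ hD] at h
  refine (ENNReal.finite_const_le_of_tsum_ne_top h one_ne_zero).subset fun e he => ?_
  rcases (hν e).zero_or_one D hD with h0 | h1
  exacts [absurd h0 he, h1.ge]

/-- A sum of product measures, one for each index tuple in a family of distinct tuples, is finite
on a box which only finitely many of the factors charge. -/
theorem sum_pi_box_lt_top {ι O S : Type*} [Fintype ι] {ρ : O → Measure X} [∀ o, SigmaFinite (ρ o)]
    {x : S → ι → O} (hx : Function.Injective x) {D : Set X} (hD : MeasurableSet D)
    (hfin : {o | ρ o D ≠ 0}.Finite) (htop : ∀ o, ρ o D ≠ ∞) :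
    Measure.sum (fun s => Measure.pi fun p => ρ (x s p)) (pi univ fun _ => D) < ∞ := by
  rw [Measure.sum_apply _ (MeasurableSet.univ_pi fun _ => hD)]
  simp_rw [Measure.pi_pi]
  have hfs : {s | ∀ p, ρ (x s p) D ≠ 0}.Finite := by
    have := (Set.Finite.pi (fun _ : ι => hfin)).preimage (f := x) hx.injOn
    refine this.subset fun s hs => ?_
    simpa using hs
  rw [tsum_eq_sum (s := hfs.toFinset)]
  · exact ENNReal.sum_lt_top.2 fun s _ => ENNReal.prod_lt_top fun p _ => (htop _).lt_top
  · intro s hs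
    simp only [ne_eq, Finite.mem_toFinset, mem_ofPred_eq, not_forall, not_not] at hs
    obtain ⟨p, hp⟩ := hs
    exact Finset.prod_eq_zero (Finset.mem_univ p) hp

theorem iUnion_pi_const_eq_univ {X ι : Type*} [Finite ι] {D : ℕ → Set X} (hmono : Monotone D)
    (hU : ⋃ k, D k = univ) : ⋃ k, pi (univ : Set ι) (fun _ => D k) = univ := by
  rw [iUnion_univ_pi_of_monotone (ι' := ℕ) (fun _ : ι => hmono)]
  simp [hU]

theorem sigmaFinite_of_box {ι : Type*} [Finite ι] {κ : Measure (ι → X)} {D : ℕ → Set X}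
    (hmono : Monotone D) (hU : ⋃ k, D k = univ)
    (hfin : ∀ k, κ (pi univ fun _ => D k) < ∞) : SigmaFinite κ :=
  ⟨⟨⟨fun k => pi univ fun _ => D k, fun _ => trivial, hfin, iUnion_pi_const_eq_univ hmono hU⟩⟩⟩

/-! ### The factorial measures of a sum of zero-one measures -/

theorem measurable_snoc {m : ℕ} : Measurable
    (fun p : (Fin m → X) × X => (Fin.snoc p.1 p.2 : Fin (m + 1) → X)) := by
  refine measurable_pi_iff.2 fun i => ?_
  refine Fin.lastCases ?_ (fun i => ?_) i
  · simpa using measurable_snd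
  · simp only [Fin.snoc_castSucc]
    fun_prop

theorem map_snoc_prod_pi {m : ℕ} (ρ : Fin m → Measure X) [∀ i, SigmaFinite (ρ i)] (ν : Measure X)
    [SigmaFinite ν] :
    ((Measure.pi ρ).prod ν).map
      (fun p : (Fin m → X) × X => (Fin.snoc p.1 p.2 : Fin (m + 1) → X)) =
    Measure.pi (Fin.snoc ρ ν : Fin (m + 1) → Measure X) := by
  have : ∀ i, SigmaFinite ((Fin.snoc ρ ν : Fin (m + 1) → Measure X) i) := by
    intro i
    refine Fin.lastCases ?_ (fun i => ?_) i
    · simpa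
    · rw [Fin.snoc_castSucc]; infer_instance
  symm
  refine Measure.pi_eq fun A hA => ?_
  rw [Measure.map_apply measurable_snoc (MeasurableSet.univ_pi hA), Fin.prod_univ_castSucc]
  simp only [Fin.snoc_castSucc, Fin.snoc_last]
  rw [← Measure.pi_pi, ← Measure.prod_prod]
  congr 1
  ext p
  simp [Fin.forall_fin_succ', mem_pi]

theorem tsum_eq_sum_add_tsum_not_mem {E : Type*} {m : ℕ} (x : Fin m ↪ E) (g : E → ℝ≥0∞) :
    ∑' e, g e = ∑ j, g (x j) + ∑' e : {e // e ∉ range x}, g e := by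
  rw [← ENNReal.summable.tsum_add_tsum_compl (s := range x) ENNReal.summable,
    tsum_range (f := g) x.injective, tsum_fintype]
  rfl

/-- Extending an embedding of `Fin m` by a new value in the last place. -/
noncomputable def snocEmbeddingEquiv (m : ℕ) (E : Type*) :
    (Σ x : Fin m ↪ E, {e // e ∉ range x}) ≃ (Fin (m + 1) ↪ E) :=
  Equiv.ofBijective (fun z => Fin.Embedding.snoc z.1 z.2.2) <| by
    constructor
    · rintro ⟨x, e, he⟩ ⟨x', e', he'⟩ h
      have h' : (Fin.snoc x e : Fin (m + 1) → E) = Fin.snoc x' e' := by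
        simpa using congrArg (fun z : Fin (m + 1) ↪ E => (z : Fin (m + 1) → E)) h
      obtain ⟨h1, h2⟩ := Fin.snoc_injective2 h'
      obtain rfl : x = x' := DFunLike.coe_injective h1
      obtain rfl := h2
      rfl
    · intro z
      refine ⟨⟨Fin.castSuccEmb.trans z, z (Fin.last m), ?_⟩, ?_⟩
      · rintro ⟨i, hi⟩
        exact (Fin.castSucc_lt_last i).ne (z.injective hi)
      · ext i
        refine Fin.lastCases ?_ (fun i => ?_) i <;> simp

/-- The factorial measure of a sum of zero-one measures is the sum of the product measures over all
tuples of distinct summands. In the recursive definition, the measures subtracted are `σ`-finite and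
are precisely the product measures for the tuples whose last entry repeats an earlier one. -/
theorem factorialMeasure_sum {E : Type*} [Countable E] {ν : E → Measure X}
    (hν : ∀ e, IsZeroOne (ν e)) [SigmaFinite (Measure.sum ν)] (m : ℕ) :
    factorialMeasure (Measure.sum ν) m =
      Measure.sum fun x : Fin m ↪ E => Measure.pi fun i => ν (x i) := by
  have hp : ∀ e, IsProbabilityMeasure (ν e) := fun e => (hν e).prob
  induction m with
  | zero =>
    rw [factorialMeasure]
    have : Unique (Fin 0 ↪ E) := Unique.mk' _
    ext B hB
    rw [Measure.sum_apply _ hB, tsum_fintype, Fintype.sum_unique, Measure.pi_of_empty _ (fun i => i.elim0)]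
  | succ m ih =>
    set D := spanningSets (Measure.sum ν)
    have hbox : ∀ (n : ℕ) k, Measure.sum (fun x : Fin n ↪ E => Measure.pi fun i => ν (x i))
        (pi univ fun _ => D k) < ∞ := fun n k =>
      sum_pi_box_lt_top (x := fun (x : Fin n ↪ E) i => x i) DFunLike.coe_injective
        (measurableSet_spanningSets _ k) (finite_setOf_measure_ne_zero hν
          (measurableSet_spanningSets _ k) (measure_spanningSets_lt_top _ k).ne)
        fun o => measure_ne_top _ _
    have hmeas : ∀ j : Fin m, Measurable
        (fun x : Fin m → X => (Fin.snoc x (x j) : Fin (m + 1) → X)) := by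
      intro j
      refine measurable_pi_iff.2 fun i => ?_
      refine Fin.lastCases ?_ (fun i => ?_) i
      · simpa using measurable_pi_apply j
      · simpa using measurable_pi_apply i
    rw [factorialMeasure, ih]
    set F := Measure.sum fun x : Fin m ↪ E => Measure.pi fun i => ν (x i)
    have hsf : SigmaFinite (∑ j : Fin m,
        F.map (fun x : Fin m → X => (Fin.snoc x (x j) : Fin (m + 1) → X))) := by
      refine sigmaFinite_of_box (D := D) (monotone_spanningSets _) (iUnion_spanningSets _)
        fun k => ?_
      rw [Measure.finsetSum_apply]
      refine ENNReal.sum_lt_top.2 fun j _ => ?_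
      rw [Measure.map_apply (hmeas j)
        (MeasurableSet.univ_pi fun _ => measurableSet_spanningSets _ k)]
      refine (measure_mono ?_).trans_lt (hbox m k)
      intro y hy i _
      simpa using hy (Fin.castSucc i) (mem_univ _)
    have hpi : ∀ (x : Fin m ↪ E) (e : E),
        ((Measure.pi fun i => ν (x i)).prod (ν e)).map
          (fun p : (Fin m → X) × X => (Fin.snoc p.1 p.2 : Fin (m + 1) → X)) =
        Measure.pi fun i => ν ((Fin.snoc x e : Fin (m + 1) → E) i) := by
      intro x e
      rw [map_snoc_prod_pi]
      congr 1
      funext i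
      refine Fin.lastCases ?_ (fun i => ?_) i <;> simp
    -- repeating the coordinate `j` of a product measure gives a product measure again, since its
    -- factors are zero-one measures
    have hdiag : ∀ (x : Fin m ↪ E) (j : Fin m),
        (Measure.pi fun i => ν (x i)).map
          (fun x : Fin m → X => (Fin.snoc x (x j) : Fin (m + 1) → X)) =
        Measure.pi fun i => ν ((Fin.snoc x (x j) : Fin (m + 1) → E) i) := by
      intro x j
      have h := map_comp_pi (fun i => ν (x i)) (Fin.snoc id j : Fin (m + 1) → Fin m)
        fun b => Or.inl (hν _)
      have e1 : (fun x : Fin m → X => (Fin.snoc x (x j) : Fin (m + 1) → X)) =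
          fun y p => y ((Fin.snoc id j : Fin (m + 1) → Fin m) p) := by
        funext y p
        refine Fin.lastCases ?_ (fun i => ?_) p <;> simp
      rw [e1, h]
      congr 1
      funext p
      refine Fin.lastCases ?_ (fun i => ?_) p <;> simp
    have hsplit : (F.prod (Measure.sum ν)).map
          (fun p : (Fin m → X) × X => (Fin.snoc p.1 p.2 : Fin (m + 1) → X)) =
        Measure.sum (fun x : Fin (m + 1) ↪ E => Measure.pi fun i => ν (x i)) +
        ∑ j : Fin m, F.map (fun x : Fin m → X => (Fin.snoc x (x j) : Fin (m + 1) → X)) := by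
      ext B hB
      rw [Measure.prod_sum, Measure.map_sum measurable_snoc.aemeasurable, Measure.sum_apply _ hB,
        ENNReal.tsum_prod', Measure.add_apply, Measure.sum_apply _ hB, Measure.finsetSum_apply]
      simp_rw [hpi, F, Measure.map_sum (hmeas _).aemeasurable, Measure.sum_apply _ hB, hdiag]
      rw [← (snocEmbeddingEquiv m E).tsum_eq, ENNReal.tsum_sigma']
      simp_rw [fun x : Fin m ↪ E => tsum_eq_sum_add_tsum_not_mem x
        (fun e => (Measure.pi fun i => ν ((Fin.snoc x e : Fin (m + 1) → E) i)) B)]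
      rw [ENNReal.tsum_add, add_comm]
      congr 1
      exact Summable.tsum_finsetSum fun _ _ => ENNReal.summable
    rw [hsplit, Measure.add_sub_cancel_of_sigmaFinite]

end ZeroOne


/-! ### Mixed factorial measures -/

/-- The factor of a product measure selected by an optional index: the intensity measure for
`none`, a zero-one summand for `some e`. -/
noncomputable def mixFactor {X E : Type*} [MeasurableSpace X] (lam : Measure X)
    (ν : E → Measure X) (o : Option E) : Measure X :=
  o.elim lam ν

/-- Index tuples whose entries in `J` are distinct proper indices, and whose entries outside `J`
are `none`. -/
abbrev AdmTuple {ι : Type*} (E : Type*) (J : Finset ι) : Type _ :=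
  {x : ι → Option E // (∀ p, x p = none ↔ p ∉ J) ∧ ∀ p q, p ∈ J → x p = x q → p = q}

/-- The image on `X^ι` of the product of `lam^{Jᶜ}` and the factorial measure
`μ^{(|J|)}` on the coordinates in `J`, for a measure `μ` that is the sum of the zero-one measures
`ν e`. -/
noncomputable def mixedFactorial {X E ι : Type*} [MeasurableSpace X] [Fintype ι] (lam : Measure X)
    (ν : E → Measure X) (J : Finset ι) : Measure (ι → X) :=
  Measure.sum fun x : AdmTuple E J => Measure.pi fun p => mixFactor lam ν (x.1 p)

section Mixed

variable {X E ι : Type*} [MeasurableSpace X] {lam : Measure X} [SigmaFinite lam]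
  {ν : E → Measure X}

theorem sigmaFinite_mixFactor (hν : ∀ e, IsZeroOne (ν e)) (o : Option E) :
    SigmaFinite (mixFactor lam ν o) := by
  cases o with
  | none => simpa [mixFactor]
  | some e => have := (hν e).prob; exact inferInstanceAs (SigmaFinite (ν e))

omit [SigmaFinite lam] in
theorem finite_setOf_mixFactor_ne_zero (hν : ∀ e, IsZeroOne (ν e))
    {D : Set X} (hD : MeasurableSet D) (h : Measure.sum ν D ≠ ∞) :
    {o | mixFactor lam ν o D ≠ 0}.Finite := by
  refine (((finite_setOf_measure_ne_zero hν hD h).image some).insert none).subset fun o ho => ?_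
  cases o with
  | none => simp
  | some e => right; exact ⟨e, ho, rfl⟩

omit [SigmaFinite lam] in
theorem mixFactor_ne_top (hν : ∀ e, IsZeroOne (ν e)) {D : Set X} (h : lam D ≠ ∞)
    (o : Option E) : mixFactor lam ν o D ≠ ∞ := by
  cases o with
  | none => exact h
  | some e => have := (hν e).prob; exact measure_ne_top (ν e) D

theorem mixedFactorial_box_lt_top [Fintype ι] (hν : ∀ e, IsZeroOne (ν e)) (J : Finset ι)
    {D : Set X} (hD : MeasurableSet D) (hl : lam D ≠ ∞) (h : Measure.sum ν D ≠ ∞) :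
    mixedFactorial lam ν J (pi univ fun _ => D) < ∞ := by
  have := sigmaFinite_mixFactor (lam := lam) hν
  exact sum_pi_box_lt_top (x := fun (x : AdmTuple E J) => x.1) Subtype.val_injective hD
    (finite_setOf_mixFactor_ne_zero hν hD h) (mixFactor_ne_top hν hl)

theorem sigmaFinite_mixedFactorial [Fintype ι] (hν : ∀ e, IsZeroOne (ν e)) (J : Finset ι)
    {D : ℕ → Set X} (hD : ∀ k, MeasurableSet (D k)) (hmono : Monotone D) (hU : ⋃ k, D k = univ)
    (hl : ∀ k, lam (D k) ≠ ∞) (h : ∀ k, Measure.sum ν (D k) ≠ ∞) :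
    SigmaFinite (mixedFactorial lam ν J) :=
  sigmaFinite_of_box hmono hU fun k => mixedFactorial_box_lt_top hν J (hD k) (hl k) (h k)

/-! ### The multiple integral as an alternating sum -/

theorem measurable_mergePoint {n : ℕ} (J : Finset (Fin n)) :
    Measurable fun z : ({j : Fin n // j ∉ J} → X) × (Fin J.card → X) =>
      mergePoint J z.2 z.1 := by
  refine measurable_pi_iff.2 fun j => ?_
  unfold mergePoint
  split_ifs <;> fun_prop

/-- Admissible tuples are the embeddings of `J`. -/
noncomputable def embeddingEquivAdmTuple {ι : Type*} [DecidableEq ι] (E : Type*) (J : Finset ι) :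
    (J ↪ E) ≃ AdmTuple E J :=
  Equiv.ofBijective (fun x => ⟨fun p => if h : p ∈ J then some (x ⟨p, h⟩) else none, by
    constructor
    · intro p
      by_cases h : p ∈ J <;> simp [h]
    · intro p q hp h
      by_cases hq : q ∈ J
      · simpa [hp, hq] using h
      · simp [hp, hq] at h⟩) <| by
    constructor
    · intro x y h
      ext i
      simpa using congrFun (congrArg Subtype.val h) i
    · rintro ⟨x, hx, hinj⟩
      have hs : ∀ p : J, ∃ e, x p = some e := fun p =>
        Option.ne_none_iff_exists'.1 fun h => (hx p).1 h p.2
      choose e he using hs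
      refine ⟨⟨e, fun i i' h => ?_⟩, ?_⟩
      · exact Subtype.ext (hinj _ _ i.2 (by rw [he, he, h]))
      · ext1
        funext p
        by_cases h : p ∈ J
        · change (if h : p ∈ J then some (e ⟨p, h⟩) else none) = x p
          rw [dif_pos h]
          exact (he ⟨p, h⟩).symm
        · simp [h, (hx p).2 h]

theorem embeddingEquivAdmTuple_apply {ι : Type*} [DecidableEq ι] {J : Finset ι} (x : J ↪ E)
    (p : J) : (embeddingEquivAdmTuple E J x).1 p = some (x p) := by
  change (if h : (p : ι) ∈ J then some (x ⟨p, h⟩) else none) = some (x p)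
  rw [dif_pos p.2]

/-- Embeddings of `Fin |J|` as embeddings of `J`, along the increasing enumeration of `J`. -/
noncomputable def finEmbeddingEquiv {n : ℕ} (E : Type*) (J : Finset (Fin n)) :
    (Fin J.card ↪ E) ≃ (J ↪ E) :=
  (J.orderIsoOfFin rfl).toEquiv.embeddingCongr (Equiv.refl E)

theorem map_mergePoint_prod_pi {n : ℕ} (J : Finset (Fin n)) (hν : ∀ e, IsZeroOne (ν e))
    (x : Fin J.card ↪ E) :
    ((Measure.pi fun _ : {j : Fin n // j ∉ J} => lam).prod (Measure.pi fun i => ν (x i))).map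
      (fun z => mergePoint J z.2 z.1) =
    Measure.pi fun p => mixFactor lam ν ((embeddingEquivAdmTuple E J (finEmbeddingEquiv E J x)).1 p) := by
  have := sigmaFinite_mixFactor (lam := lam) hν
  have hp : ∀ e, IsProbabilityMeasure (ν e) := fun e => (hν e).prob
  symm
  refine Measure.pi_eq fun A hA => ?_
  rw [Measure.map_apply (measurable_mergePoint J) (MeasurableSet.univ_pi hA)]
  have hpre : (fun z : ({j : Fin n // j ∉ J} → X) × (Fin J.card → X) => mergePoint J z.2 z.1) ⁻¹'
      (pi univ A) = (pi univ fun j : {j : Fin n // j ∉ J} => A j) ×ˢ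
        (pi univ fun i => A (J.orderIsoOfFin rfl i)) := by
    ext z
    simp only [mem_preimage, mem_pi, mem_univ, true_implies, mem_prod, mergePoint]
    constructor
    · intro h
      refine ⟨fun j => ?_, fun i => ?_⟩
      · simpa [j.2] using h j
      · simpa [-Finset.coe_orderIsoOfFin_apply] using h (J.orderIsoOfFin rfl i)
    · rintro ⟨h1, h2⟩ j
      split_ifs with hj
      · simpa using h2 ((J.orderIsoOfFin rfl).symm ⟨j, hj⟩)
      · exact h1 ⟨j, hj⟩
  rw [hpre, Measure.prod_prod, Measure.pi_pi, Measure.pi_pi,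
    ← Fintype.prod_subtype_mul_prod_subtype (fun p => p ∈ J), mul_comm]
  congr 1
  · refine (Fintype.prod_equiv (J.orderIsoOfFin rfl).toEquiv _ (fun p : J => mixFactor lam ν
      ((embeddingEquivAdmTuple E J (finEmbeddingEquiv E J x)).1 p) (A p)) fun i => ?_).trans
      (Finset.prod_congr (by ext; simp) fun _ _ => rfl)
    rw [embeddingEquivAdmTuple_apply]
    simp [finEmbeddingEquiv, mixFactor]
  · refine Finset.prod_congr rfl fun j _ => ?_
    rw [((embeddingEquivAdmTuple E J (finEmbeddingEquiv E J x)).2.1 j).2 j.2]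
    rfl

theorem mixedFactorial_eq_map [Countable E] {n : ℕ} (J : Finset (Fin n))
    (hν : ∀ e, IsZeroOne (ν e)) [SigmaFinite (Measure.sum ν)] :
    mixedFactorial lam ν J =
      ((Measure.pi fun _ : {j : Fin n // j ∉ J} => lam).prod
        (factorialMeasure (Measure.sum ν) J.card)).map (fun z => mergePoint J z.2 z.1) := by
  have hp : ∀ e, IsProbabilityMeasure (ν e) := fun e => (hν e).prob
  have : Countable (Fin J.card ↪ E) := DFunLike.coe_injective.countable
  rw [factorialMeasure_sum hν, Measure.prod_sum_right,
    Measure.map_sum (measurable_mergePoint J).aemeasurable]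
  simp_rw [map_mergePoint_prod_pi J hν]
  ext B hB
  rw [mixedFactorial, Measure.sum_apply _ hB, Measure.sum_apply _ hB,
    ← ((finEmbeddingEquiv E J).trans (embeddingEquivAdmTuple E J)).tsum_eq]
  rfl

/-- If `f` is integrable for all mixed factorial measures, then no junk value enters the iterated
integrals in the definition of the multiple integral. -/
theorem wienerIto_eq_sum [Countable E] (hν : ∀ e, IsZeroOne (ν e)) [SigmaFinite (Measure.sum ν)]
    {n : ℕ} {f : (Fin n → X) → ℝ} (hf : ∀ J, Integrable f (mixedFactorial lam ν J)) :
    wienerIto lam f (Measure.sum ν) =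
      ∑ J : Finset (Fin n), (-1 : ℝ) ^ (n - J.card) * ∫ x, f x ∂(mixedFactorial lam ν J) := by
  have hp : ∀ e, IsProbabilityMeasure (ν e) := fun e => (hν e).prob
  unfold wienerIto
  refine Finset.sum_congr rfl fun J _ => ?_
  congr 1
  have hJ := hf J
  have : Countable (Fin J.card ↪ E) := DFunLike.coe_injective.countable
  have : SFinite (factorialMeasure (Measure.sum ν) J.card) := by
    rw [factorialMeasure_sum hν]; infer_instance
  rw [mixedFactorial_eq_map J hν] at hJ ⊢
  rw [integral_map (measurable_mergePoint J).aemeasurable hJ.aestronglyMeasurable,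
    integral_prod]
  exact (integrable_map_measure hJ.aestronglyMeasurable
    (measurable_mergePoint J).aemeasurable).1 hJ

end Mixed


/-! ### Falling factorials and the Poisson distribution -/

/-- The falling factorial `t (t - 1) ⋯ (t - k + 1)` with truncated subtraction in `[0, ∞]`. -/
noncomputable def fallingFactorial (k : ℕ) (t : ℝ≥0∞) : ℝ≥0∞ :=
  ∏ i ∈ Finset.range k, (t - i)

theorem measurable_fallingFactorial (k : ℕ) : Measurable (fallingFactorial k) := by
  unfold fallingFactorial
  fun_prop

theorem fallingFactorial_natCast (k N : ℕ) :
    fallingFactorial k (N : ℝ≥0∞) = (N.descFactorial k : ℕ) := by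
  rw [Nat.descFactorial_eq_prod_range, fallingFactorial]
  push_cast
  simp

theorem descFactorial_mul_poisson_weight (k m : ℕ) (r : ℝ≥0) :
    (((m + k).descFactorial k : ℕ) : ℝ≥0∞) * poissonMeasure r {m + k} =
      (r : ℝ≥0∞) ^ k * poissonMeasure r {m} := by
  have h0 : (m.factorial : ℝ) * ((m + k).descFactorial k : ℝ) = ((m + k).factorial : ℝ) := by
    have := Nat.factorial_mul_descFactorial (Nat.le_add_left k m)
    rw [Nat.add_sub_cancel] at this
    exact_mod_cast this
  have h1 : (m.factorial : ℝ) ≠ 0 := by positivity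
  have h2 : ((m + k).descFactorial k : ℝ) ≠ 0 := fun h => by
    have : ((m + k).factorial : ℝ) ≠ 0 := by positivity
    rw [← h0, h, mul_zero] at this
    exact this rfl
  rw [poissonMeasure_singleton, poissonMeasure_singleton, ← ENNReal.ofReal_natCast,
    ← ENNReal.ofReal_coe_nnreal, ← ENNReal.ofReal_pow r.coe_nonneg,
    ← ENNReal.ofReal_mul (Nat.cast_nonneg _), ← ENNReal.ofReal_mul (pow_nonneg r.coe_nonneg _), ← h0]
  congr 1
  generalize ((m + k).descFactorial k : ℝ) = a at *
  field_simp
  ring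

theorem lintegral_fallingFactorial_poissonLaw (k : ℕ) {c : ℝ≥0∞} (hc : c ≠ ∞) :
    ∫⁻ t, fallingFactorial k t ∂(poissonLaw c) = c ^ k := by
  rw [poissonLaw, if_neg hc, lintegral_map (measurable_fallingFactorial k) (by fun_prop),
    lintegral_countable']
  simp_rw [fallingFactorial_natCast]
  rw [← ENNReal.summable.sum_add_tsum_nat_add' (k := k), Finset.sum_eq_zero, zero_add]
  · simp_rw [descFactorial_mul_poisson_weight]
    have h1 : ∑' m, poissonMeasure c.toNNReal {m} = 1 := by
      have := lintegral_countable' (μ := poissonMeasure c.toNNReal) (fun _ => 1)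
      simpa using this.symm
    rw [ENNReal.tsum_mul_left, h1, mul_one, ENNReal.coe_toNNReal hc]
  · intro m hm
    rw [Nat.descFactorial_eq_zero_iff_lt.2 (Finset.mem_range.1 hm), Nat.cast_zero, zero_mul]

/-! ### Mixed factorial measures of rectangles -/

/-- Embeddings that send every point into the set of its colour split into one embedding for each
colour, when the sets of distinct colours are disjoint. -/
def colouredEmbeddingEquiv {κ E C : Type*} (col : κ → C) (S : C → Set E)
    (hS : Pairwise fun c c' => Disjoint (S c) (S c')) :
    {x : κ ↪ E // ∀ p, x p ∈ S (col p)} ≃ ∀ c, {p // col p = c} ↪ S c where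
  toFun x c := ⟨fun p => ⟨x.1 p, by have := x.2 p; rwa [p.2] at this⟩, fun p q h =>
    Subtype.ext (x.1.injective (congrArg Subtype.val h))⟩
  invFun y := ⟨⟨fun p => (y (col p) ⟨p, rfl⟩ : E), fun p q h => by
      have h' : (y (col p) ⟨p, rfl⟩ : E) = y (col q) ⟨q, rfl⟩ := h
      have hcol : col p = col q := by
        by_contra hne
        exact Set.disjoint_left.1 (hS hne) (y (col p) ⟨p, rfl⟩).2
          (h' ▸ (y (col q) ⟨q, rfl⟩).2)
      have gen : ∀ c (hc : col q = c), (y (col q) ⟨q, rfl⟩ : E) = y c ⟨q, hc⟩ := by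
        rintro _ rfl; rfl
      have h2 : (y (col p) ⟨p, rfl⟩ : E) = y (col p) ⟨q, hcol.symm⟩ := h'.trans (gen _ _)
      simpa using (y (col p)).injective (Subtype.ext h2)⟩,
    fun p => (y (col p) ⟨p, rfl⟩).2⟩
  left_inv x := rfl
  right_inv y := by
    funext c
    ext ⟨p, rfl⟩
    rfl

section Rectangle

variable {X E ι : Type*} [MeasurableSpace X] {lam : Measure X} [SigmaFinite lam]
  {ν : E → Measure X}

/-- The summands charging a set `B c` are finitely many, as many as the value of the sum on `B c`,
and no summand charges two disjoint sets; so the left-hand side counts coloured embeddings. -/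
theorem tsum_embedding_prod {κ C : Type*} [Fintype κ] [Fintype C] [DecidableEq C]
    (hν : ∀ e, IsZeroOne (ν e)) (col : κ → C) {B : C → Set X} (hB : ∀ c, MeasurableSet (B c))
    (hdis : Pairwise fun c c' => Disjoint (B c) (B c')) (hfin : ∀ c, Measure.sum ν (B c) ≠ ∞) :
    ∑' x : κ ↪ E, ∏ p, ν (x p) (B (col p)) =
      ∏ c, fallingFactorial (Fintype.card {p // col p = c}) (Measure.sum ν (B c)) := by
  classical
  have hp : ∀ e, IsProbabilityMeasure (ν e) := fun e => (hν e).prob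
  set S : C → Set E := fun c => {e | ν e (B c) ≠ 0}
  have hSfin : ∀ c, (S c).Finite := fun c => finite_setOf_measure_ne_zero hν (hB c) (hfin c)
  have hval : ∀ c e, ν e (B c) = (S c).indicator 1 e := by
    intro c e
    by_cases h : ν e (B c) = 0
    · rw [indicator_of_notMem (by simpa [S] using h), h]
    · rw [indicator_of_mem (by simpa [S] using h)]
      exact ((hν e).zero_or_one _ (hB c)).resolve_left h
  have hS : Pairwise fun c c' => Disjoint (S c) (S c') := by
    intro c c' hcc
    refine Set.disjoint_left.2 fun e h h' => ?_
    have h1 := ((hν e).zero_or_one _ (hB c)).resolve_left h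
    have h2 := ((hν e).zero_or_one _ (hB c')).resolve_left h'
    have h3 := (hν e).measure_inter (B := B c') (hB c)
    rw [(hdis hcc).inter_eq, h1, h2] at h3
    simp at h3
  have hcard : ∀ c, Measure.sum ν (B c) = ((hSfin c).toFinset.card : ℝ≥0∞) := by
    intro c
    rw [Measure.sum_apply _ (hB c), tsum_eq_sum (s := (hSfin c).toFinset)]
    · rw [Finset.card_eq_sum_ones, Nat.cast_sum]
      refine Finset.sum_congr rfl fun e he => ?_
      rw [hval, indicator_of_mem ((hSfin c).mem_toFinset.1 he)]; simp
    · intro e he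
      rw [hval, indicator_of_notMem (by simpa using he)]
  have hFin : ∀ c, Fintype (S c) := fun c => (hSfin c).fintype
  have : Fintype {x : κ ↪ E // ∀ p, x p ∈ S (col p)} :=
    Fintype.ofEquiv _ (colouredEmbeddingEquiv col S hS).symm
  have h1 : ∀ x : κ ↪ E, ∏ p, ν (x p) (B (col p)) =
      {x : κ ↪ E | ∀ p, x p ∈ S (col p)}.indicator 1 x := by
    intro x
    simp_rw [hval]
    by_cases h : ∀ p, x p ∈ S (col p)
    · rw [indicator_of_mem (by exact h)]
      exact Finset.prod_eq_one fun p _ => by rw [indicator_of_mem (h p)]; rfl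
    · rw [indicator_of_notMem (by exact h)]
      push Not at h
      obtain ⟨p, hp⟩ := h
      exact Finset.prod_eq_zero (Finset.mem_univ p) (indicator_of_notMem hp _)
  simp_rw [h1]
  rw [← tsum_subtype]
  change ∑' x : {x : κ ↪ E // ∀ p, x p ∈ S (col p)}, (1 : ℝ≥0∞) = _
  rw [tsum_fintype, Finset.sum_const, Finset.card_univ,
    Fintype.card_congr (colouredEmbeddingEquiv col S hS), Fintype.card_pi]
  simp only [nsmul_eq_mul, mul_one, Nat.cast_prod]
  refine Finset.prod_congr rfl fun c _ => ?_
  rw [hcard, fallingFactorial_natCast, Fintype.card_embedding_eq,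
    Set.Finite.card_toFinset]

theorem mixedFactorial_pi [Fintype ι] [DecidableEq ι] {C : Type*} [Fintype C] [DecidableEq C]
    (hν : ∀ e, IsZeroOne (ν e)) (J : Finset ι) (col : ι → C) {B : C → Set X}
    (hB : ∀ c, MeasurableSet (B c)) (hdis : Pairwise fun c c' => Disjoint (B c) (B c'))
    (hfin : ∀ c, Measure.sum ν (B c) ≠ ∞) :
    mixedFactorial lam ν J (pi univ fun p => B (col p)) =
      (∏ p : {p // p ∉ J}, lam (B (col p))) *
      ∏ c, fallingFactorial (Fintype.card {p : J // col p = c}) (Measure.sum ν (B c)) := by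
  have := sigmaFinite_mixFactor (lam := lam) hν
  rw [mixedFactorial, Measure.sum_apply _ (MeasurableSet.univ_pi fun p => hB _),
    ← (embeddingEquivAdmTuple E J).tsum_eq, ← tsum_embedding_prod hν _ hB hdis hfin,
    ← ENNReal.tsum_mul_left]
  refine tsum_congr fun x => ?_
  rw [Measure.pi_pi, ← Fintype.prod_subtype_mul_prod_subtype (fun p => p ∈ J), mul_comm]
  congr 1
  · refine Finset.prod_congr rfl fun j _ => ?_
    rw [((embeddingEquivAdmTuple E J x).2.1 j).2 j.2]
    rfl
  · refine Eq.trans (Finset.prod_congr (by ext; simp) fun p _ => ?_) rfl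
    rw [embeddingEquivAdmTuple_apply]
    rfl

end Rectangle


/-! ### Boxes with equal or disjoint sides -/

/-- Boxes inside some `D k ^ ι` any two sides of which are equal or disjoint. Unlike general boxes,
these have factorial moments that are determined by the counts of disjoint sets. -/
def diagonalBoxes {X : Type*} [MeasurableSpace X] (ι : Type*) (D : ℕ → Set X) :
    Set (Set (ι → X)) :=
  {R | ∃ (k : ℕ) (A : ι → Set X), (∀ p, MeasurableSet (A p)) ∧ (∀ p, A p ⊆ D k) ∧
    (∀ p q, A p = A q ∨ Disjoint (A p) (A q)) ∧ R = pi univ A}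

section Boxes

variable {X ι : Type*} [MeasurableSpace X] {D : ℕ → Set X}

theorem isPiSystem_diagonalBoxes : IsPiSystem (diagonalBoxes ι D) := by
  rintro _ ⟨k, A, hA, hAD, hd, rfl⟩ _ ⟨k', A', hA', _, hd', rfl⟩ _
  refine ⟨k, fun p => A p ∩ A' p, fun p => (hA p).inter (hA' p),
    fun p => inter_subset_left.trans (hAD p), fun p q => ?_, by rw [pi_inter_distrib]⟩
  rcases hd p q with h | h
  · rcases hd' p q with h' | h'
    · exact Or.inl (congrArg₂ _ h h')
    · right; exact h'.mono inter_subset_right inter_subset_right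
  · right; exact h.mono inter_subset_left inter_subset_left

theorem measurableSet_of_mem_diagonalBoxes [Countable ι] {R : Set (ι → X)}
    (hR : R ∈ diagonalBoxes ι D) : MeasurableSet R := by
  obtain ⟨k, A, hA, -, -, rfl⟩ := hR
  exact MeasurableSet.univ_pi hA

theorem box_mem_diagonalBoxes (hD : ∀ k, MeasurableSet (D k)) (k : ℕ) :
    (pi univ fun _ => D k) ∈ diagonalBoxes ι D :=
  ⟨k, fun _ => D k, fun _ => hD k, fun _ => subset_rfl, fun _ _ => Or.inl rfl, rfl⟩

theorem generateFrom_diagonalBoxes [Finite ι] (hD : ∀ k, MeasurableSet (D k))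
    (hmono : Monotone D) (hU : ⋃ k, D k = univ) :
    (MeasurableSpace.pi : MeasurableSpace (ι → X)) =
      MeasurableSpace.generateFrom (diagonalBoxes ι D) := by
  classical
  refine le_antisymm ?_ (MeasurableSpace.generateFrom_le fun R hR =>
    measurableSet_of_mem_diagonalBoxes hR)
  refine iSup_le fun p => ?_
  rintro _ ⟨S, hS, rfl⟩
  -- a cylinder is a union of boxes all of whose sides are `D k ∩ S` or `D k \ S`
  have hcyl : Function.eval p ⁻¹' S = ⋃ (k : ℕ) (T : {T : ι → Bool // T p = true}),
      pi univ (fun q => if T.1 q then D k ∩ S else D k \ S) := by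
    ext x
    simp only [mem_preimage, Function.eval, mem_iUnion, mem_pi, mem_univ, true_implies]
    constructor
    · intro hx
      have hxU : x ∈ ⋃ k, pi (univ : Set ι) (fun _ => D k) := by
        rw [iUnion_pi_const_eq_univ hmono hU]; trivial
      obtain ⟨k, hk⟩ := mem_iUnion.1 hxU
      refine ⟨k, ⟨fun q => decide (x q ∈ S), by simpa using hx⟩, fun q => ?_⟩
      have := hk q trivial
      by_cases h : x q ∈ S <;> simp [h, this]
    · rintro ⟨k, T, h⟩
      have := h p
      rw [T.2] at this
      exact this.2
  rw [hcyl]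
  refine MeasurableSet.iUnion fun k => MeasurableSet.iUnion fun T =>
    MeasurableSpace.measurableSet_generateFrom
      ⟨k, _, fun q => ?_, fun q => ?_, fun q q' => ?_, rfl⟩
  · split_ifs
    exacts [(hD k).inter hS, (hD k).diff hS]
  · split_ifs
    exacts [inter_subset_left, sdiff_subset]
  · have hdis : Disjoint (D k ∩ S) (D k \ S) :=
      Set.disjoint_left.2 fun x h h' => h'.2 h.2
    split_ifs
    exacts [Or.inl rfl, Or.inr hdis, Or.inr hdis.symm, Or.inl rfl]

/-- The sides of a box with equal or disjoint sides, listed without repetition. -/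
theorem exists_colouring [Fintype ι] {A : ι → Set X} (hA : ∀ p, MeasurableSet (A p)) {S : Set X}
    (hS : ∀ p, A p ⊆ S) (hd : ∀ p q, A p = A q ∨ Disjoint (A p) (A q)) :
    ∃ (k : ℕ) (col : ι → Fin k) (B : Fin k → Set X), (∀ c, MeasurableSet (B c)) ∧
      (∀ c, B c ⊆ S) ∧ (Pairwise fun c c' => Disjoint (B c) (B c')) ∧
      A = fun p => B (col p) := by
  classical
  set 𝒜 := Finset.univ.image A
  have hmem : ∀ p, A p ∈ 𝒜 := fun p => Finset.mem_image_of_mem _ (Finset.mem_univ p)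
  have hex : ∀ c : 𝒜, ∃ p, A p = c := fun c => by
    obtain ⟨p, -, hp⟩ := Finset.mem_image.1 c.2
    exact ⟨p, hp⟩
  refine ⟨𝒜.card, fun p => 𝒜.equivFin ⟨A p, hmem p⟩, fun c => (𝒜.equivFin.symm c : Set X),
    fun c => ?_, fun c => ?_, fun c c' hcc => ?_, ?_⟩
  · obtain ⟨p, hp⟩ := hex (𝒜.equivFin.symm c)
    exact (congrArg MeasurableSet hp).mp (hA p)
  · obtain ⟨p, hp⟩ := hex (𝒜.equivFin.symm c)
    exact hp.symm.subset.trans (hS p)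
  · obtain ⟨p, hp⟩ := hex (𝒜.equivFin.symm c)
    obtain ⟨q, hq⟩ := hex (𝒜.equivFin.symm c')
    have := hd p q
    rw [hp, hq] at this
    refine this.resolve_left fun h => hcc ?_
    exact 𝒜.equivFin.symm.injective (Subtype.ext h)
  · funext p
    simp

end Boxes

/-! ### Mixed factorial moment measures of a Poisson process -/

/-- A Poisson process with intensity `lam` whose realizations are written as countable sums of
zero-one measures `ν ω e`, and are finite on each member of an exhausting sequence `D` of sets of
finite intensity. The labels of the summands need not depend on `ω` in a measurable way. -/
structure IsSplitPoisson {Ω X : Type*} [MeasurableSpace Ω] [MeasurableSpace X] (P : Measure Ω)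
    (lam : Measure X) (D : ℕ → Set X) {E : Ω → Type} (ν : ∀ ω, E ω → Measure X) : Prop where
  measurableSet (k) : MeasurableSet (D k)
  monotone : Monotone D
  iUnion : ⋃ k, D k = univ
  intensity_ne_top (k) : lam (D k) ≠ ∞
  countable (ω) : Countable (E ω)
  isZeroOne (ω) (e) : IsZeroOne (ν ω e)
  ne_top (ω) (k) : Measure.sum (ν ω) (D k) ≠ ∞
  measurable : Measurable fun ω => Measure.sum (ν ω)
  map_eq : ∀ B, MeasurableSet B → P.map (fun ω => Measure.sum (ν ω) B) = poissonLaw (lam B)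
  indep : ∀ (k : ℕ) (B : Fin k → Set X), (∀ i, MeasurableSet (B i)) →
    Pairwise (fun i j => Disjoint (B i) (B j)) → iIndepFun (fun i ω => Measure.sum (ν ω) (B i)) P

namespace IsSplitPoisson

variable {Ω X ι : Type*} [MeasurableSpace Ω] [MeasurableSpace X] [Fintype ι] {P : Measure Ω}
  {lam : Measure X} [SigmaFinite lam] {D : ℕ → Set X} {E : Ω → Type} {ν : ∀ ω, E ω → Measure X}

include D

/-- On a box with equal or disjoint sides, a mixed factorial measure is a product of falling
factorials of the independent Poisson counts of the distinct sides. -/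
theorem mixedFactorial_diagonalBox (h : IsSplitPoisson P lam D ν) (J : Finset ι)
    {R : Set (ι → X)} (hR : R ∈ diagonalBoxes ι D) :
    Measurable (fun ω => mixedFactorial lam (ν ω) J R) ∧
      ∫⁻ ω, mixedFactorial lam (ν ω) J R ∂P = Measure.pi (fun _ => lam) R := by
  classical
  obtain ⟨k, A, hA, hAD, hd, rfl⟩ := hR
  obtain ⟨K, col, B, hB, hBD, hdis, rfl⟩ := exists_colouring hA hAD hd
  have hfin : ∀ ω c, Measure.sum (ν ω) (B c) ≠ ∞ := fun ω c =>
    ((measure_mono (hBD c)).trans_lt (h.ne_top ω k).lt_top).ne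
  have hlam : ∀ c, lam (B c) ≠ ∞ := fun c =>
    ((measure_mono (hBD c)).trans_lt (h.intensity_ne_top k).lt_top).ne
  have hval := fun ω => mixedFactorial_pi (lam := lam) (h.isZeroOne ω) J col hB hdis (hfin ω)
  have hmeas : ∀ c, Measurable fun ω => Measure.sum (ν ω) (B c) := fun c =>
    Measure.measurable_measure.1 h.measurable _ (hB c)
  simp_rw [hval]
  have hm : ∀ c : Fin K, Measurable fun ω =>
      fallingFactorial (Fintype.card {p : J // col p = c}) (Measure.sum (ν ω) (B c)) := fun c =>
    (measurable_fallingFactorial _).comp (hmeas c)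
  refine ⟨(Finset.univ.measurable_prod fun c _ => hm c).const_mul _, ?_⟩
  rw [lintegral_const_mul _ (Finset.univ.measurable_prod fun c _ => hm c),
    lintegral_prod_eq_prod_lintegral_of_indepFun Finset.univ
      (fun (c : Fin K) ω => fallingFactorial (Fintype.card {p : J // col p = c})
        (Measure.sum (ν ω) (B c)))
      ((h.indep K B hB hdis).comp
        (fun c => fallingFactorial (Fintype.card {p : J // col p = c}))
        fun c => measurable_fallingFactorial _) hm]
  have hint : ∀ c : Fin K, ∫⁻ ω, fallingFactorial (Fintype.card {p : J // col p = c})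
      (Measure.sum (ν ω) (B c)) ∂P = ∏ _p : {p : J // col p = c}, lam (B c) := by
    intro c
    rw [← lintegral_map (f := fallingFactorial _) (measurable_fallingFactorial _) (hmeas c),
      h.map_eq _ (hB c), lintegral_fallingFactorial_poissonLaw _ (hlam c), Finset.prod_const,
      Finset.card_univ]
  simp_rw [hint]
  rw [Measure.pi_pi, ← Fintype.prod_subtype_mul_prod_subtype (fun p => p ∈ J), mul_comm]
  congr 1
  have h1 : ∏ c, ∏ _p : {p : J // col p = c}, lam (B c) = ∏ p : J, lam (B (col p)) := by
    rw [← Fintype.prod_fiberwise (fun p : J => col p)]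
    exact Finset.prod_congr rfl fun c _ => Finset.prod_congr rfl fun p _ => by rw [p.2]
  rw [h1]
  exact Finset.prod_congr (by ext; simp) fun _ _ => rfl

/-- The values on boxes with equal or disjoint sides are measurable; these boxes form a generating
`π`-system, and the mixed factorial measures are finite on the boxes with all sides `D k`. -/
theorem measurable_mixedFactorial (h : IsSplitPoisson P lam D ν) (J : Finset ι) :
    Measurable fun ω => mixedFactorial lam (ν ω) J := by
  set box : ℕ → Set (ι → X) := fun k => pi univ fun _ => D k
  have hbox : ∀ k, MeasurableSet (box k) := fun k => MeasurableSet.univ_pi fun _ =>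
    h.measurableSet k
  have hres : ∀ k, Measurable fun ω => (mixedFactorial lam (ν ω) J).restrict (box k) := by
    intro k
    have : ∀ ω, IsFiniteMeasure ((mixedFactorial lam (ν ω) J).restrict (box k)) := fun ω =>
      ⟨by
        rw [Measure.restrict_apply_univ]
        exact mixedFactorial_box_lt_top (h.isZeroOne ω) J (h.measurableSet k)
          (h.intensity_ne_top k) (h.ne_top ω k)⟩
    refine Measurable.measure_of_isPiSystem
      (generateFrom_diagonalBoxes h.measurableSet h.monotone h.iUnion)
      isPiSystem_diagonalBoxes (fun R hR => ?_) ?_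
    · simp_rw [Measure.restrict_apply (measurableSet_of_mem_diagonalBoxes hR)]
      rcases (R ∩ box k).eq_empty_or_nonempty with he | hne
      · simp [he]
      · exact (h.mixedFactorial_diagonalBox J (isPiSystem_diagonalBoxes R hR _
          (box_mem_diagonalBoxes h.measurableSet k) hne)).1
    · simp_rw [Measure.restrict_apply_univ]
      exact (h.mixedFactorial_diagonalBox J (box_mem_diagonalBoxes h.measurableSet k)).1
  refine Measure.measurable_measure.2 fun S hS => ?_
  have hmono : Monotone fun k => S ∩ box k := fun i j hij =>
    inter_subset_inter_right _ (pi_mono fun _ _ => h.monotone hij)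
  have hS' : S = ⋃ k, S ∩ box k := by
    rw [← inter_iUnion, iUnion_pi_const_eq_univ h.monotone h.iUnion, inter_univ]
  have : (fun ω => mixedFactorial lam (ν ω) J S) =
      fun ω => ⨆ k, (mixedFactorial lam (ν ω) J).restrict (box k) S := by
    funext ω
    conv_lhs => rw [hS', hmono.measure_iUnion]
    simp_rw [Measure.restrict_apply hS]
  rw [this]
  exact Measurable.iSup fun k => Measure.measurable_measure.1 (hres k) S hS

/-- The multivariate Mecke (Campbell) formula: the expectation of a mixed factorial measure is the
power of the intensity measure. -/
theorem bind_mixedFactorial (h : IsSplitPoisson P lam D ν) (J : Finset ι) :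
    P.bind (fun ω => mixedFactorial lam (ν ω) J) = Measure.pi fun _ => lam := by
  symm
  refine Measure.ext_of_generateFrom_of_iUnion (diagonalBoxes ι D)
    (fun k => pi univ fun _ => D k)
    (generateFrom_diagonalBoxes h.measurableSet h.monotone h.iUnion) isPiSystem_diagonalBoxes
    (iUnion_pi_const_eq_univ h.monotone h.iUnion) (box_mem_diagonalBoxes h.measurableSet)
    (fun k => ?_) fun R hR => ?_
  · rw [Measure.pi_pi]
    exact (ENNReal.prod_lt_top fun _ _ => (h.intensity_ne_top k).lt_top).ne
  · rw [Measure.bind_apply (measurableSet_of_mem_diagonalBoxes hR)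
      (h.measurable_mixedFactorial J).aemeasurable, (h.mixedFactorial_diagonalBox J hR).2]

end IsSplitPoisson

/-! ### Integrals with respect to a mixture of measures -/

section Bind

variable {Ω Y : Type*} [MeasurableSpace Ω] [MeasurableSpace Y] {P : Measure Ω}
  {κ : Ω → Measure Y} {μ : Measure Y} {f : Y → ℝ}

theorem ae_integrable_of_bind_eq (hκ : Measurable κ) (hμ : P.bind κ = μ) (hf : Measurable f)
    (hint : Integrable f μ) : ∀ᵐ ω ∂P, Integrable f (κ ω) := by
  have h1 : ∫⁻ ω, ∫⁻ y, ‖f y‖ₑ ∂(κ ω) ∂P ≠ ∞ := by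
    rw [← Measure.lintegral_bind hκ.aemeasurable hf.enorm.aemeasurable, hμ]
    exact hint.2.ne
  have h2 : Measurable fun ω => ∫⁻ y, ‖f y‖ₑ ∂(κ ω) :=
    (Measure.measurable_lintegral hf.enorm).comp hκ
  filter_upwards [ae_lt_top h2 h1] with ω hω
  exact ⟨hf.aestronglyMeasurable, hω⟩

theorem integrable_integral_of_bind_eq (hκ : Measurable κ) (hμ : P.bind κ = μ) (hf : Measurable f)
    (hint : Integrable f μ) :
    Integrable (fun ω => ∫ y, f y ∂(κ ω)) P ∧ ∫ ω, ∫ y, f y ∂(κ ω) ∂P = ∫ y, f y ∂μ := by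
  -- the measurability in `ω` and the identity are obtained from the Lebesgue integrals of the
  -- positive and the negative part
  have aux : ∀ g : Y → ℝ, Measurable g → Integrable g μ →
      Integrable (fun ω => (∫⁻ y, ENNReal.ofReal (g y) ∂(κ ω)).toReal) P ∧
      ∫ ω, (∫⁻ y, ENNReal.ofReal (g y) ∂(κ ω)).toReal ∂P =
        (∫⁻ y, ENNReal.ofReal (g y) ∂μ).toReal := by
    intro g hg hgi
    have hm : Measurable fun ω => ∫⁻ y, ENNReal.ofReal (g y) ∂(κ ω) :=
      (Measure.measurable_lintegral hg.ennreal_ofReal).comp hκ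
    have he : ∫⁻ ω, ∫⁻ y, ENNReal.ofReal (g y) ∂(κ ω) ∂P = ∫⁻ y, ENNReal.ofReal (g y) ∂μ := by
      rw [← hμ, Measure.lintegral_bind hκ.aemeasurable hg.ennreal_ofReal.aemeasurable]
    have hfin : ∫⁻ ω, ∫⁻ y, ENNReal.ofReal (g y) ∂(κ ω) ∂P ≠ ∞ := by
      rw [he]; exact hgi.lintegral_lt_top.ne
    refine ⟨integrable_toReal_of_lintegral_ne_top hm.aemeasurable hfin, ?_⟩
    rw [integral_toReal hm.aemeasurable (ae_lt_top hm hfin), he]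
  obtain ⟨i1, e1⟩ := aux f hf hint
  obtain ⟨i2, e2⟩ := aux (fun y => -f y) hf.neg hint.neg
  have hae : (fun ω => ∫ y, f y ∂(κ ω)) =ᵐ[P] fun ω =>
      (∫⁻ y, ENNReal.ofReal (f y) ∂(κ ω)).toReal -
        (∫⁻ y, ENNReal.ofReal (-f y) ∂(κ ω)).toReal := by
    filter_upwards [ae_integrable_of_bind_eq hκ hμ hf hint] with ω hω
    exact integral_eq_lintegral_pos_part_sub_lintegral_neg_part hω
  refine ⟨(i1.sub i2).congr hae.symm, ?_⟩
  rw [integral_congr_ae hae, integral_sub i1 i2, e1, e2,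
    integral_eq_lintegral_pos_part_sub_lintegral_neg_part hint]

end Bind


/-! ### Products of multiple integrals -/

theorem tsum_pi_prod {I : Type} [Fintype I] : ∀ (α : I → Type) (g : ∀ i, α i → ℝ≥0∞),
    ∑' a : ∀ i, α i, ∏ i, g i (a i) = ∏ i, ∑' a, g i a := by
  classical
  refine Fintype.induction_empty_option (P := fun I _ => ∀ (α : I → Type)
    (g : ∀ i, α i → ℝ≥0∞), ∑' a : ∀ i, α i, ∏ i, g i (a i) = ∏ i, ∑' a, g i a) ?_ ?_ ?_ I
  · intro I I' _ e ih α g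
    let := Fintype.ofEquiv I' e.symm
    rw [← (Equiv.piCongrLeft α e).tsum_eq, ← e.prod_comp, ← ih (fun i => α (e i)) fun i => g (e i)]
    refine tsum_congr fun a => ?_
    rw [← e.prod_comp]
    refine Finset.prod_congr rfl fun i _ => ?_
    rw [Equiv.piCongrLeft_apply_apply]
  · intro α g
    rw [tsum_fintype]
    simp
  · intro I _ ih α g
    rw [Fintype.prod_option, ← Equiv.piOptionEquivProd.symm.tsum_eq, ENNReal.tsum_prod',
      ← ih, ← ENNReal.tsum_mul_right]
    refine tsum_congr fun a => ?_
    rw [← ENNReal.tsum_mul_left]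
    refine tsum_congr fun b => ?_
    rw [Fintype.prod_option]
    rfl

/-- The disjoint union of rows of lengths `n i`. -/
abbrev Cell {I : Type} (n : I → ℕ) : Type := Σ i, Fin (n i)

instance {α : Type*} [Finite α] : Finite (Setoid α) :=
  Finite.of_injective (fun s : Setoid α => (s.r : α → α → Prop)) fun _ _ h =>
    Setoid.ext fun a b => iff_of_eq (congrFun (congrFun h a) b)

noncomputable instance {α : Type*} [Finite α] : Fintype (Setoid α) := Fintype.ofFinite _

section Curry

variable {X : Type*} [MeasurableSpace X] {I : Type} [Fintype I] {n : I → ℕ}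

theorem pi_map_curry (ρ : Cell n → Measure X) [∀ p, SigmaFinite (ρ p)] :
    (Measure.pi ρ).map (fun x i k => x ⟨i, k⟩) =
      Measure.pi fun i => Measure.pi fun k : Fin (n i) => ρ ⟨i, k⟩ := by
  have h : Measure.pi ρ = (Measure.pi fun i => Measure.pi fun k : Fin (n i) => ρ ⟨i, k⟩).map
      (fun x p => x p.1 p.2) := by
    refine Measure.pi_eq fun A hA => ?_
    rw [Measure.map_apply (by fun_prop) (MeasurableSet.univ_pi hA), Fintype.prod_sigma]
    have : (fun (x : ∀ i, Fin (n i) → X) (p : Cell n) => x p.1 p.2) ⁻¹' (pi univ A) =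
        pi univ fun i => pi univ fun k => A ⟨i, k⟩ := by
      ext x
      simp only [mem_preimage, mem_pi, mem_univ, true_implies]
      exact ⟨fun h i k => h ⟨i, k⟩, fun h p => h p.1 p.2⟩
    rw [this, Measure.pi_pi]
    simp_rw [Measure.pi_pi]
  rw [h, Measure.map_map (by fun_prop) (by fun_prop)]
  exact Measure.map_id

end Curry

/-! ### Diagrams as equivalence relations -/

/-- No two distinct cells of a row are equivalent. -/
def NonFlat {I : Type} {n : I → ℕ} (σ : Setoid (Cell n)) : Prop :=
  ∀ p q, σ p q → p.1 = q.1 → p = q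

/-- The class of `p` is `{p}`. -/
def IsSingle {α : Type*} (σ : Setoid α) (p : α) : Prop := ∀ q, σ p q → q = p

/-- A non-flat relation under which the cells outside the sets `J i` are alone in their class. -/
def Compatible {I : Type} {n : I → ℕ} (J : ∀ i, Finset (Fin (n i))) (σ : Setoid (Cell n)) : Prop :=
  NonFlat σ ∧ ∀ p : Cell n, p.2 ∉ J p.1 → IsSingle σ p

open scoped Classical in
/-- The classes meeting the union of the sets `J i`. -/
noncomputable def activeClasses {I : Type} [Fintype I] {n : I → ℕ} (J : ∀ i, Finset (Fin (n i)))
    (σ : Setoid (Cell n)) : Finset (Quotient σ) :=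
  Finset.univ.filter fun b => ∃ p : Cell n, p.2 ∈ J p.1 ∧ Quotient.mk σ p = b

section Product

open scoped Classical

variable {X : Type*} [MeasurableSpace X] {lam : Measure X} [SigmaFinite lam] {E : Type}
  {ν : E → Measure X} {I : Type} [Fintype I] {n : I → ℕ}

theorem Compatible.mk_mem_activeClasses {J : ∀ i, Finset (Fin (n i))} {σ : Setoid (Cell n)}
    (h : Compatible J σ) (p : Cell n) :
    Quotient.mk σ p ∈ activeClasses J σ ↔ p.2 ∈ J p.1 := by
  simp only [activeClasses, Finset.mem_filter, Finset.mem_univ, true_and]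
  constructor
  · rintro ⟨q, hq, hqp⟩
    by_contra hp
    have := h.2 p hp q (σ.symm (Quotient.exact hqp))
    exact hp (this ▸ hq)
  · exact fun hp => ⟨p, hp, rfl⟩

/-- A compatible relation together with distinct labels of its active classes is the same as one
admissible tuple for each row: the relation records which entries of different rows agree. -/
noncomputable def compatibleEquiv (E : Type) (J : ∀ i, Finset (Fin (n i))) :
    (Σ σ : {σ : Setoid (Cell n) // Compatible J σ}, AdmTuple E (activeClasses J σ.1)) ≃
      ∀ i, AdmTuple E (J i) :=
  Equiv.ofBijective (fun z i => ⟨fun k => z.2.1 (Quotient.mk z.1.1 ⟨i, k⟩), by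
    constructor
    · intro k
      rw [z.2.2.1, z.1.2.mk_mem_activeClasses]
    · intro k l hk hkl
      have h1 := z.2.2.2 _ _ ((z.1.2.mk_mem_activeClasses ⟨i, k⟩).2 hk) hkl
      have h2 := z.1.2.1 _ _ (Quotient.exact h1) rfl
      simpa using h2⟩) <| by
    constructor
    · rintro ⟨⟨σ, hσ⟩, y⟩ ⟨⟨τ, hτ⟩, w⟩ h
      have hx : ∀ p : Cell n, y.1 (Quotient.mk σ p) = w.1 (Quotient.mk τ p) := fun p =>
        congrFun (congrArg Subtype.val (congrFun h p.1)) p.2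
      have hrel : ∀ (ρ : Setoid (Cell n)) (hρ : Compatible J ρ)
          (v : AdmTuple E (activeClasses J ρ)) (p q : Cell n), ρ p q ↔
            p = q ∨ (p.2 ∈ J p.1 ∧ v.1 (Quotient.mk ρ p) = v.1 (Quotient.mk ρ q)) := by
        intro ρ hρ v p q
        constructor
        · intro hpq
          by_cases hp : p.2 ∈ J p.1
          · right; exact ⟨hp, congrArg v.1 (Quotient.sound hpq)⟩
          · left; exact (hρ.2 p hp q hpq).symm
        · rintro (rfl | ⟨hp, hpq⟩)
          · exact ρ.refl p
          · exact Quotient.exact (v.2.2 _ _ ((hρ.mk_mem_activeClasses p).2 hp) hpq)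
      obtain rfl : σ = τ := Setoid.ext fun p q => by
        rw [hrel σ hσ y, hrel τ hτ w, hx, hx]
      obtain rfl : y = w := by
        ext1
        funext b
        induction b using Quotient.inductionOn with
        | _ p => exact hx p
      rfl
    · intro z
      set x : Cell n → Option E := fun p => (z p.1).1 p.2
      have hxn : ∀ p : Cell n, x p = none ↔ p.2 ∉ J p.1 := fun p => (z p.1).2.1 p.2
      let σ : Setoid (Cell n) :=
        { r := fun p q => p = q ∨ (x p ≠ none ∧ x p = x q)
          iseqv := ⟨fun p => Or.inl rfl, by
            rintro p q (rfl | ⟨h1, h2⟩)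
            · exact Or.inl rfl
            · exact Or.inr ⟨h2 ▸ h1, h2.symm⟩, by
            rintro p q r (rfl | ⟨h1, h2⟩) (rfl | ⟨h3, h4⟩)
            · exact Or.inl rfl
            · exact Or.inr ⟨h3, h4⟩
            · exact Or.inr ⟨h1, h2⟩
            · exact Or.inr ⟨h1, h2.trans h4⟩⟩ }
      have hσ : Compatible J σ := by
        constructor
        · rintro ⟨i, k⟩ ⟨j, l⟩ (h | ⟨h1, h2⟩) hij
          · exact h
          · obtain rfl : i = j := hij
            have := (z i).2.2 k l (by
              by_contra hk
              exact h1 ((hxn ⟨i, k⟩).2 hk)) h2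
            rw [this]
        · rintro p hp q (rfl | ⟨h1, h2⟩)
          · rfl
          · exact absurd ((hxn p).2 hp) h1
      have hlift : ∀ p q : Cell n, σ p q → x p = x q := by
        rintro p q (rfl | ⟨-, h⟩)
        exacts [rfl, h]
      refine ⟨⟨⟨σ, hσ⟩, ⟨Quotient.lift x hlift, ?_, ?_⟩⟩, rfl⟩
      · intro b
        induction b using Quotient.inductionOn with
        | _ p => rw [hσ.mk_mem_activeClasses]; exact hxn p
      · intro b c hb hbc
        induction b using Quotient.inductionOn with
        | _ p =>
          induction c using Quotient.inductionOn with
          | _ q =>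
            refine Quotient.sound (Or.inr ⟨fun hn => ?_, hbc⟩)
            exact (hxn p).1 hn ((hσ.mk_mem_activeClasses p).1 hb)

/-- The product formula: a product of mixed factorial measures is a sum over the relations that
identify entries of different rows. -/
theorem pi_mixedFactorial (hν : ∀ e, IsZeroOne (ν e)) (J : ∀ i, Finset (Fin (n i)))
    [∀ i, SigmaFinite (mixedFactorial lam ν (J i))] :
    Measure.pi (fun i => mixedFactorial lam ν (J i)) =
      ∑ σ : {σ : Setoid (Cell n) // Compatible J σ},
        (mixedFactorial lam ν (activeClasses J σ.1)).map
          (fun y i k => y (Quotient.mk σ.1 ⟨i, k⟩)) := by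
  have := sigmaFinite_mixFactor (lam := lam) hν
  refine Measure.pi_eq fun A hA => ?_
  have hAm := MeasurableSet.univ_pi hA
  have hmeas : ∀ σ : Setoid (Cell n), Measurable
      (fun (y : Quotient σ → X) (i : I) (k : Fin (n i)) => y (Quotient.mk σ ⟨i, k⟩)) :=
    fun σ => by fun_prop
  have hterm : ∀ (σ : {σ : Setoid (Cell n) // Compatible J σ})
      (y : AdmTuple E (activeClasses J σ.1)),
      (Measure.pi fun b => mixFactor lam ν (y.1 b)).map
          (fun y i k => y (Quotient.mk σ.1 ⟨i, k⟩)) =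
        Measure.pi fun i => Measure.pi fun k =>
          mixFactor lam ν ((compatibleEquiv E J ⟨σ, y⟩ i).1 k) := by
    intro σ y
    have h1 := map_comp_pi (fun b => mixFactor lam ν (y.1 b)) (Quotient.mk σ.1) (fun b => by
      induction b using Quotient.inductionOn with
      | _ p =>
        by_cases hp : p.2 ∈ J p.1
        -- an active class carries a zero-one measure, any other class has one element
        · left
          have : y.1 (Quotient.mk σ.1 p) ≠ none := fun h =>
            (y.2.1 _).1 h ((σ.2.mk_mem_activeClasses p).2 hp)
          obtain ⟨e, he⟩ := Option.ne_none_iff_exists'.1 this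
          rw [he]
          exact hν e
        · right
          refine ⟨p, fun q => ⟨fun h => ?_, fun h => h ▸ rfl⟩⟩
          exact σ.2.2 p hp q (σ.1.symm (Quotient.exact h)))
    have h2 := pi_map_curry (fun p : Cell n => mixFactor lam ν (y.1 (Quotient.mk σ.1 p)))
    rw [← h1, Measure.map_map (by fun_prop) (by fun_prop)] at h2
    exact h2
  rw [Measure.finsetSum_apply]
  have hmap : ∀ σ : {σ : Setoid (Cell n) // Compatible J σ},
      (mixedFactorial lam ν (activeClasses J σ.1)).map
          (fun y i k => y (Quotient.mk σ.1 ⟨i, k⟩)) (pi univ A) =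
        ∑' y : AdmTuple E (activeClasses J σ.1), ∏ i,
          (Measure.pi fun k => mixFactor lam ν ((compatibleEquiv E J ⟨σ, y⟩ i).1 k)) (A i) := by
    intro σ
    rw [mixedFactorial, Measure.map_sum (hmeas σ.1).aemeasurable, Measure.sum_apply _ hAm]
    refine tsum_congr fun y => ?_
    rw [hterm, Measure.pi_pi]
  simp_rw [hmap]
  rw [← tsum_fintype (L := SummationFilter.unconditional _), ← ENNReal.tsum_sigma' (fun z : Σ σ : {σ : Setoid (Cell n) // Compatible J σ},
    AdmTuple E (activeClasses J σ.1) => ∏ i,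
      (Measure.pi fun k => mixFactor lam ν ((compatibleEquiv E J z i).1 k)) (A i)),
    (compatibleEquiv E J).tsum_eq (fun z => ∏ i,
      (Measure.pi fun k => mixFactor lam ν ((z i).1 k)) (A i)),
    tsum_pi_prod (fun i => AdmTuple E (J i)) (fun i z =>
      (Measure.pi fun k => mixFactor lam ν (z.1 k)) (A i))]
  refine Finset.prod_congr rfl fun i _ => ?_
  rw [mixedFactorial, Measure.sum_apply _ (hA i)]

end Product


/-! ### The moment formula -/

/-- The multiple integral of `f` with respect to the compensated sum of the zero-one measures
`ν e`. -/
noncomputable def splitIntegral {X E : Type*} [MeasurableSpace X] (lam : Measure X)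
    (ν : E → Measure X) {m : ℕ} (f : (Fin m → X) → ℝ) : ℝ :=
  ∑ J : Finset (Fin m), (-1 : ℝ) ^ (m - J.card) * ∫ x, f x ∂(mixedFactorial lam ν J)

open scoped Classical in
/-- The integral of the tensor product of the functions `f i` after identification of the arguments
in a common class of `σ`. -/
noncomputable def diagramIntegral {X : Type*} [MeasurableSpace X] (lam : Measure X) {I : Type}
    [Fintype I] {n : I → ℕ} (f : ∀ i, (Fin (n i) → X) → ℝ) (σ : Setoid (Cell n)) : ℝ :=
  ∫ y : Quotient σ → X, ∏ i, f i (fun k => y (Quotient.mk σ ⟨i, k⟩)) ∂(Measure.pi fun _ => lam)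

open scoped Classical in
/-- Integrability of the tensor product of the functions `f i` after identification of the
arguments in a common class of `σ`. -/
def DiagramIntegrable {X : Type*} [MeasurableSpace X] (lam : Measure X) {I : Type}
    [Fintype I] {n : I → ℕ} (f : ∀ i, (Fin (n i) → X) → ℝ) (σ : Setoid (Cell n)) : Prop :=
  Integrable (fun y : Quotient σ → X => ∏ i, f i (fun k => y (Quotient.mk σ ⟨i, k⟩)))
    (Measure.pi fun _ => lam)

/-- Non-flat relations all of whose classes have at least two elements. -/
def NonFlatTwo {I : Type} {n : I → ℕ} (σ : Setoid (Cell n)) : Prop :=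
  NonFlat σ ∧ ∀ p, ¬ IsSingle σ p

section Sign

open scoped Classical

variable {I : Type} [Fintype I] {n : I → ℕ}

/-- The alternating sum over the subsets of cells which are integrated against the intensity
measure cancels every relation with a one-element class. -/
theorem sum_sign_compatible (σ : Setoid (Cell n)) :
    ∑ J : ∀ i, Finset (Fin (n i)), (∏ i, (-1 : ℝ) ^ (n i - (J i).card)) *
      (if Compatible J σ then 1 else 0) = if NonFlatTwo σ then 1 else 0 := by
  by_cases hσ : NonFlat σ
  swap
  · rw [if_neg (fun h => hσ h.1)]
    exact Finset.sum_eq_zero fun J _ => by rw [if_neg (fun h => hσ h.1), mul_zero]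
  -- the sum factorizes over the cells, with the factor `1 - s p` for the cell `p`: each cell either
  -- belongs to its set `J i`, or must be alone in its class
  set s : Cell n → ℝ := fun p => if IsSingle σ p then 1 else 0
  have hterm : ∀ J : ∀ i, Finset (Fin (n i)), (∏ i, (-1 : ℝ) ^ (n i - (J i).card)) *
      (if Compatible J σ then 1 else 0) = ∏ i, ∏ k ∈ Finset.univ \ J i, -s ⟨i, k⟩ := by
    intro J
    have h1 : (if Compatible J σ then (1 : ℝ) else 0) =
        ∏ i, ∏ k ∈ Finset.univ \ J i, s ⟨i, k⟩ := by
      split_ifs with h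
      · refine (Finset.prod_eq_one fun i _ => Finset.prod_eq_one fun k hk => ?_).symm
        exact if_pos (h.2 ⟨i, k⟩ (Finset.mem_sdiff.1 hk).2)
      · have : ∃ p : Cell n, p.2 ∉ J p.1 ∧ ¬ IsSingle σ p := by
          by_contra hcon
          push Not at hcon
          exact h ⟨hσ, hcon⟩
        obtain ⟨p, hp, hps⟩ := this
        refine (Finset.prod_eq_zero (Finset.mem_univ p.1) (Finset.prod_eq_zero
          (Finset.mem_sdiff.2 ⟨Finset.mem_univ p.2, hp⟩) ?_)).symm
        exact if_neg hps
    rw [h1, ← Finset.prod_mul_distrib]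
    refine Finset.prod_congr rfl fun i _ => ?_
    rw [Finset.prod_neg, Finset.card_sdiff_of_subset (Finset.subset_univ _), Finset.card_univ,
      Fintype.card_fin]
  simp_rw [hterm]
  have h2 := Finset.prod_univ_sum (fun i => (Finset.univ : Finset (Finset (Fin (n i)))))
    (fun i J => ∏ k ∈ Finset.univ \ J, -s ⟨i, k⟩)
  rw [Fintype.piFinset_univ] at h2
  rw [← h2]
  have h3 : ∀ i, ∑ J : Finset (Fin (n i)), ∏ k ∈ Finset.univ \ J, -s ⟨i, k⟩ =
      ∏ k, (1 - s ⟨i, k⟩) := by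
    intro i
    simp_rw [sub_eq_add_neg]
    rw [Finset.prod_add, Finset.powerset_univ]
    simp
  simp_rw [h3]
  rw [← Fintype.prod_sigma (fun p : Cell n => 1 - s p)]
  split_ifs with h
  · refine Finset.prod_eq_one fun p _ => ?_
    rw [show s p = 0 from if_neg (h.2 p), sub_zero]
  · have : ∃ p, IsSingle σ p := by
      by_contra hcon
      push Not at hcon
      exact h ⟨hσ, hcon⟩
    obtain ⟨p, hp⟩ := this
    refine Finset.prod_eq_zero (Finset.mem_univ p) ?_
    rw [show s p = 1 from if_pos hp, sub_self]

end Sign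

namespace IsSplitPoisson

open scoped Classical

variable {Ω X : Type*} [MeasurableSpace Ω] [MeasurableSpace X] {P : Measure Ω}
  {lam : Measure X} [SigmaFinite lam] {D : ℕ → Set X} {E : Ω → Type} {ν : ∀ ω, E ω → Measure X}
  {I : Type} [Fintype I] {n : I → ℕ} {f : ∀ i, (Fin (n i) → X) → ℝ}

include D

theorem ae_integrable (h : IsSplitPoisson P lam D ν) {m : ℕ} {g : (Fin m → X) → ℝ}
    (hg : Measurable g) (hint : Integrable g (Measure.pi fun _ => lam)) :
    ∀ᵐ ω ∂P, ∀ J, Integrable g (mixedFactorial lam (ν ω) J) :=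
  ae_all_iff.2 fun J => ae_integrable_of_bind_eq (h.measurable_mixedFactorial J)
    (h.bind_mixedFactorial J) hg hint

theorem ae_prod_integral_eq (h : IsSplitPoisson P lam D ν) (hf : ∀ i, Measurable (f i))
    (hd : ∀ σ : Setoid (Cell n), NonFlat σ → DiagramIntegrable lam f σ) :
    ∀ᵐ ω ∂P, ∀ J : ∀ i, Finset (Fin (n i)),
      ∏ i, ∫ x, f i x ∂(mixedFactorial lam (ν ω) (J i)) =
        ∑ σ : {σ : Setoid (Cell n) // Compatible J σ}, ∫ y : Quotient σ.1 → X,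
          ∏ i, f i (fun k => y (Quotient.mk σ.1 ⟨i, k⟩))
            ∂(mixedFactorial lam (ν ω) (activeClasses J σ.1)) := by
  have hFm : ∀ σ : Setoid (Cell n), Measurable
      (fun y : Quotient σ → X => ∏ i, f i (fun k => y (Quotient.mk σ ⟨i, k⟩))) := fun σ =>
    Finset.univ.measurable_prod fun i _ => (hf i).comp (by fun_prop)
  have h2 : ∀ᵐ ω ∂P, ∀ (J : ∀ i, Finset (Fin (n i)))
      (σ : {σ : Setoid (Cell n) // Compatible J σ}),
      Integrable (fun y : Quotient σ.1 → X => ∏ i, f i (fun k => y (Quotient.mk σ.1 ⟨i, k⟩)))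
        (mixedFactorial lam (ν ω) (activeClasses J σ.1)) :=
    ae_all_iff.2 fun J => ae_all_iff.2 fun σ => ae_integrable_of_bind_eq
      (h.measurable_mixedFactorial _) (h.bind_mixedFactorial _) (hFm σ.1) (hd σ.1 σ.2.1)
  filter_upwards [h2] with ω hω J
  have hsf : ∀ i, SigmaFinite (mixedFactorial lam (ν ω) (J i)) := fun i =>
    sigmaFinite_mixedFactorial (h.isZeroOne ω) (J i) h.measurableSet h.monotone h.iUnion
      h.intensity_ne_top (h.ne_top ω)
  have hG : Measurable fun x : ∀ i, Fin (n i) → X => ∏ i, f i (x i) :=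
    Finset.univ.measurable_prod fun i _ => (hf i).comp (by fun_prop)
  have hm : ∀ σ : Setoid (Cell n), Measurable
      (fun (y : Quotient σ → X) (i : I) (k : Fin (n i)) => y (Quotient.mk σ ⟨i, k⟩)) :=
    fun σ => by fun_prop
  rw [← integral_fintype_prod_eq_prod, pi_mixedFactorial (h.isZeroOne ω),
    integral_finsetSum_measure]
  · refine Finset.sum_congr rfl fun σ _ => ?_
    rw [integral_map (hm σ.1).aemeasurable hG.aestronglyMeasurable]
  · intro σ _
    rw [integrable_map_measure hG.aestronglyMeasurable (hm σ.1).aemeasurable]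
    exact hω J σ

/-- The moment formula for multiple integrals. -/
theorem integral_prod_splitIntegral (h : IsSplitPoisson P lam D ν) (hf : ∀ i, Measurable (f i))
    (hd : ∀ σ : Setoid (Cell n), NonFlat σ → DiagramIntegrable lam f σ) :
    Integrable (fun ω => ∏ i, splitIntegral lam (ν ω) (f i)) P ∧
      ∫ ω, ∏ i, splitIntegral lam (ν ω) (f i) ∂P =
        ∑ σ : Setoid (Cell n) with NonFlatTwo σ, diagramIntegral lam f σ := by
  have hFm : ∀ σ : Setoid (Cell n), Measurable
      (fun y : Quotient σ → X => ∏ i, f i (fun k => y (Quotient.mk σ ⟨i, k⟩))) := fun σ =>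
    Finset.univ.measurable_prod fun i _ => (hf i).comp (by fun_prop)
  have hterm : ∀ (J : ∀ i, Finset (Fin (n i))) (σ : {σ : Setoid (Cell n) // Compatible J σ}),
      Integrable (fun ω => ∫ y : Quotient σ.1 → X, ∏ i, f i (fun k => y (Quotient.mk σ.1 ⟨i, k⟩))
        ∂(mixedFactorial lam (ν ω) (activeClasses J σ.1))) P ∧
      ∫ ω, ∫ y : Quotient σ.1 → X, ∏ i, f i (fun k => y (Quotient.mk σ.1 ⟨i, k⟩))
        ∂(mixedFactorial lam (ν ω) (activeClasses J σ.1)) ∂P = diagramIntegral lam f σ.1 :=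
    fun J σ => integrable_integral_of_bind_eq
      (h.measurable_mixedFactorial _) (h.bind_mixedFactorial _) (hFm σ.1) (hd σ.1 σ.2.1)
  have hae : (fun ω => ∏ i, splitIntegral lam (ν ω) (f i)) =ᵐ[P] fun ω =>
      ∑ J : ∀ i, Finset (Fin (n i)), (∏ i, (-1 : ℝ) ^ (n i - (J i).card)) *
        ∑ σ : {σ : Setoid (Cell n) // Compatible J σ}, ∫ y : Quotient σ.1 → X,
          ∏ i, f i (fun k => y (Quotient.mk σ.1 ⟨i, k⟩))
            ∂(mixedFactorial lam (ν ω) (activeClasses J σ.1)) := by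
    filter_upwards [h.ae_prod_integral_eq hf hd] with ω hω
    have h2 := Finset.prod_univ_sum (fun i => (Finset.univ : Finset (Finset (Fin (n i)))))
      (fun i J => (-1 : ℝ) ^ (n i - J.card) * ∫ x, f i x ∂(mixedFactorial lam (ν ω) J))
    rw [Fintype.piFinset_univ] at h2
    simp only [splitIntegral]
    rw [h2]
    refine Finset.sum_congr rfl fun J _ => ?_
    rw [Finset.prod_mul_distrib, hω J]
  have hi : ∀ J : ∀ i, Finset (Fin (n i)), Integrable (fun ω =>
      (∏ i, (-1 : ℝ) ^ (n i - (J i).card)) *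
        ∑ σ : {σ : Setoid (Cell n) // Compatible J σ}, ∫ y : Quotient σ.1 → X,
          ∏ i, f i (fun k => y (Quotient.mk σ.1 ⟨i, k⟩))
            ∂(mixedFactorial lam (ν ω) (activeClasses J σ.1))) P := fun J =>
    (integrable_finsetSum _ fun σ _ => (hterm J σ).1).const_mul _
  refine ⟨(integrable_finsetSum _ fun J _ => hi J).congr hae.symm, ?_⟩
  rw [integral_congr_ae hae, integral_finsetSum _ fun J _ => hi J]
  have hJ : ∀ J : ∀ i, Finset (Fin (n i)), ∫ ω, (∏ i, (-1 : ℝ) ^ (n i - (J i).card)) *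
        ∑ σ : {σ : Setoid (Cell n) // Compatible J σ}, ∫ y : Quotient σ.1 → X,
          ∏ i, f i (fun k => y (Quotient.mk σ.1 ⟨i, k⟩))
            ∂(mixedFactorial lam (ν ω) (activeClasses J σ.1)) ∂P =
      ∑ σ : Setoid (Cell n), ((∏ i, (-1 : ℝ) ^ (n i - (J i).card)) *
        (if Compatible J σ then 1 else 0)) * diagramIntegral lam f σ := by
    intro J
    rw [integral_const_mul, integral_finsetSum _ fun σ _ => (hterm J σ).1, Finset.mul_sum]
    simp_rw [(hterm J _).2]
    refine (Finset.sum_subtype (Finset.univ.filter fun σ => Compatible J σ) (by simp)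
      (fun σ => (∏ i, (-1 : ℝ) ^ (n i - (J i).card)) * diagramIntegral lam f σ)).symm.trans ?_
    rw [Finset.sum_filter]
    refine Finset.sum_congr rfl fun σ _ => ?_
    split_ifs <;> simp
  simp_rw [hJ]
  rw [Finset.sum_comm, Finset.sum_filter]
  refine Finset.sum_congr rfl fun σ _ => ?_
  rw [← Finset.sum_mul, sum_sign_compatible]
  split_ifs <;> simp

end IsSplitPoisson


/-! ### The moment-cumulant recursion -/

section Recursion

variable {ι : Type*} [DecidableEq ι]

/-- The solution `κ` of the recursion `m S = ∑ κ T * m (S \ T)`, the sum extending over the subsets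
`T` of `S` that contain `j`, for sets `S` containing `j`. -/
noncomputable def recCumulant (m : Finset ι → ℂ) (j : ι) (S : Finset ι) : ℂ :=
  (m S - ∑ T ∈ S.ssubsets.attach,
    if j ∈ T.1 then recCumulant m j T.1 * m (S \ T.1) else 0) / m ∅
termination_by S.card
decreasing_by exact Finset.card_lt_card (Finset.mem_ssubsets.1 T.2)

theorem recCumulant_eq (m : Finset ι → ℂ) (j : ι) (S : Finset ι) :
    recCumulant m j S = (m S - ∑ T ∈ S.ssubsets,
      if j ∈ T then recCumulant m j T * m (S \ T) else 0) / m ∅ := by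
  rw [recCumulant]
  congr 2
  exact Finset.sum_attach S.ssubsets
    (fun T => if j ∈ T then recCumulant m j T * m (S \ T) else 0)

theorem moment_eq_add_sum_ssubsets {m : Finset ι → ℂ} (h0 : m ∅ ≠ 0) (j : ι) (S : Finset ι) :
    m S = recCumulant m j S * m ∅ +
      ∑ T ∈ S.ssubsets, if j ∈ T then recCumulant m j T * m (S \ T) else 0 := by
  rw [recCumulant_eq m j S]
  field_simp
  ring

theorem sum_powerset_eq_add_sum_ssubsets {M : Type*} [AddCommMonoid M] (g : Finset ι → M)
    (S : Finset ι) : ∑ T ∈ S.powerset, g T = g S + ∑ T ∈ S.ssubsets, g T := by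
  rw [Finset.ssubsets, Finset.add_sum_erase _ _ (Finset.mem_powerset_self S)]

theorem moment_eq_sum_powerset {m : Finset ι → ℂ} (h0 : m ∅ ≠ 0) {j : ι} {S : Finset ι}
    (hj : j ∈ S) :
    m S = ∑ T ∈ S.powerset, if j ∈ T then recCumulant m j T * m (S \ T) else 0 := by
  rw [sum_powerset_eq_add_sum_ssubsets, if_pos hj, Finset.sdiff_self]
  exact moment_eq_add_sum_ssubsets h0 j S

/-- If the partial derivatives of `m S` are `m (insert i S)`, then the solution of the recursion
has the same property. -/
theorem hasDerivAt_recCumulant {m : (ι → ℝ) → Finset ι → ℂ} {z : ι → ℝ} {i j : ι}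
    (hm : ∀ S, i ∉ S →
      HasDerivAt (fun t => m (Function.update z i t) S) (m z (insert i S)) (z i))
    (h0 : m z ∅ ≠ 0) (hij : i ≠ j) (S : Finset ι) : j ∈ S → i ∉ S →
    HasDerivAt (fun t => recCumulant (m (Function.update z i t)) j S)
      (recCumulant (m z) j (insert i S)) (z i) := by
  induction S using Finset.strongInduction with
  | H S ih =>
    intro hj hi
    have hz : Function.update z i (z i) = z := Function.update_eq_self i z
    set κ := recCumulant (m z) j
    have hsum : HasDerivAt (fun t => ∑ T ∈ S.ssubsets, if j ∈ T then
        recCumulant (m (Function.update z i t)) j T * m (Function.update z i t) (S \ T) else 0)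
        (∑ T ∈ S.ssubsets, if j ∈ T then
          κ (insert i T) * m z (S \ T) + κ T * m z (insert i (S \ T)) else 0) (z i) := by
      refine HasDerivAt.fun_sum fun T hT => ?_
      have hTS := Finset.mem_ssubsets.1 hT
      split_ifs with hjT
      · have h1 := ih T hTS hjT fun h => hi (hTS.1 h)
        have h2 := hm (S \ T) fun h => hi (Finset.mem_sdiff.1 h).1
        have h3 := h1.fun_mul h2
        rwa [hz] at h3
      · exact hasDerivAt_const _ _
    have hdiv := ((hm S hi).fun_sub hsum).fun_div (hm ∅ (Finset.notMem_empty i)) (by rwa [hz])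
    simp_rw [← recCumulant_eq] at hdiv
    refine hdiv.congr_deriv ?_
    rw [hz]
    -- by the quotient rule, the claim is a combination of the recursions for `S` and `insert i S`;
    -- in the second one the subsets are grouped according to whether they contain `i`
    have e1 := moment_eq_add_sum_ssubsets h0 j S
    have e2 := moment_eq_sum_powerset h0 (Finset.mem_insert_of_mem (b := i) hj)
    rw [Finset.sum_powerset_insert hi, sum_powerset_eq_add_sum_ssubsets,
      sum_powerset_eq_add_sum_ssubsets, if_pos hj, if_pos (Finset.mem_insert_of_mem hj),
      Finset.sdiff_self, Finset.insert_sdiff_of_notMem _ hi, Finset.sdiff_self] at e2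
    have e3 : (∑ T ∈ S.ssubsets, if j ∈ T then κ T * m z (insert i S \ T) else 0) +
        (∑ T ∈ S.ssubsets, if j ∈ insert i T then κ (insert i T) * m z (insert i S \ insert i T)
          else 0) = ∑ T ∈ S.ssubsets, if j ∈ T then
          κ (insert i T) * m z (S \ T) + κ T * m z (insert i (S \ T)) else 0 := by
      rw [← Finset.sum_add_distrib]
      refine Finset.sum_congr rfl fun T hT => ?_
      have hTS := Finset.mem_ssubsets.1 hT
      have hiT : i ∉ T := fun h => hi (hTS.1 h)
      have hins : insert i S \ insert i T = S \ T := by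
        ext x
        simp only [Finset.mem_sdiff, Finset.mem_insert]
        constructor
        · tauto
        · rintro ⟨h1, h2⟩
          refine ⟨Or.inr h1, ?_⟩
          rintro (rfl | h)
          exacts [hi h1, h2 h]
      have hmem : j ∈ insert i T ↔ j ∈ T := by
        rw [Finset.mem_insert]
        exact or_iff_right hij.symm
      simp only [hmem, hins, Finset.insert_sdiff_of_notMem _ hiT]
      split_ifs <;> ring
    rw [← e3]
    rw [div_eq_iff (pow_ne_zero 2 h0)]
    linear_combination (m z ∅) * e2 - (m z (insert i ∅)) * e1

/-- The recursion determines its solution. -/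
theorem recCumulant_eq_of_recursion {m C : Finset ι → ℂ} (h0 : m ∅ = 1) {j : ι}
    (hC : ∀ S, j ∈ S → m S = ∑ T ∈ S.powerset, if j ∈ T then C T * m (S \ T) else 0)
    (S : Finset ι) : j ∈ S → recCumulant m j S = C S := by
  induction S using Finset.strongInduction with
  | H S ih =>
    intro hj
    have e := hC S hj
    rw [sum_powerset_eq_add_sum_ssubsets, if_pos hj, Finset.sdiff_self, h0, mul_one] at e
    rw [recCumulant_eq, h0, div_one, e, sub_eq_iff_eq_add]
    congr 1
    refine Finset.sum_congr rfl fun T hT => ?_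
    split_ifs with h
    · rw [ih T (Finset.mem_ssubsets.1 hT) h]
    · rfl

end Recursion

section Derivative

variable {Ω : Type*} [MeasurableSpace Ω] {P : Measure Ω} {ℓ : ℕ}
  {Y : Fin ℓ → Ω → ℝ}

/-- The mixed partial derivative, once in each of the variables in `S`, of the joint
characteristic function. -/
noncomputable def charMoment (P : Measure Ω) (Y : Fin ℓ → Ω → ℝ) (z : Fin ℓ → ℝ)
    (S : Finset (Fin ℓ)) : ℂ :=
  ∫ ω, (∏ i ∈ S, (Complex.I * (Y i ω : ℂ))) *
    Complex.exp (Complex.I * ((∑ j, z j * Y j ω : ℝ) : ℂ)) ∂P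

theorem norm_exp_I_mul_ofReal (x : ℝ) : ‖Complex.exp (Complex.I * (x : ℂ))‖ = 1 := by
  rw [mul_comm]; exact Complex.norm_exp_ofReal_mul_I x

theorem integrable_charMoment (hY : ∀ i, AEStronglyMeasurable (Y i) P) {S : Finset (Fin ℓ)}
    (hS : Integrable (fun ω => ∏ i ∈ S, Y i ω) P) (z : Fin ℓ → ℝ) :
    Integrable (fun ω => (∏ i ∈ S, (Complex.I * (Y i ω : ℂ))) *
      Complex.exp (Complex.I * ((∑ j, z j * Y j ω : ℝ) : ℂ))) P := by
  have h1 : AEStronglyMeasurable (fun ω => ∑ j, z j * Y j ω) P :=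
    Finset.aestronglyMeasurable_fun_sum _ fun j _ => (hY j).const_mul (z j)
  have h2 : AEStronglyMeasurable (fun ω => ∏ i ∈ S, (Complex.I * (Y i ω : ℂ))) P :=
    Finset.aestronglyMeasurable_fun_prod _ fun i _ =>
      (Complex.continuous_ofReal.comp_aestronglyMeasurable (hY i)).const_mul _
  have h3 : AEStronglyMeasurable
      (fun ω => Complex.exp (Complex.I * ((∑ j, z j * Y j ω : ℝ) : ℂ))) P :=
    (show Continuous fun x : ℝ => Complex.exp (Complex.I * (x : ℂ)) by
      fun_prop).comp_aestronglyMeasurable h1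
  refine hS.mono (h2.mul h3) (Filter.Eventually.of_forall fun ω => ?_)
  rw [norm_mul, norm_exp_I_mul_ofReal, mul_one, norm_prod, norm_prod]
  refine le_of_eq (Finset.prod_congr rfl fun i _ => ?_)
  simp

theorem hasDerivAt_charMoment (hY : ∀ S : Finset (Fin ℓ), Integrable (fun ω => ∏ i ∈ S, Y i ω) P)
    (z : Fin ℓ → ℝ) {i : Fin ℓ} {S : Finset (Fin ℓ)} (hi : i ∉ S) :
    HasDerivAt (fun t => charMoment P Y (Function.update z i t) S)
      (charMoment P Y z (insert i S)) (z i) := by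
  have hm : ∀ i, AEStronglyMeasurable (Y i) P := fun i => by
    simpa using (hY {i}).aestronglyMeasurable
  have key := hasDerivAt_integral_of_dominated_loc_of_deriv_le (μ := P) (x₀ := z i)
    (s := Set.univ) (bound := fun ω => ‖∏ k ∈ insert i S, Y k ω‖)
    (F := fun t ω => (∏ k ∈ S, (Complex.I * (Y k ω : ℂ))) *
      Complex.exp (Complex.I * ((∑ j, Function.update z i t j * Y j ω : ℝ) : ℂ)))
    (F' := fun t ω => (∏ k ∈ insert i S, (Complex.I * (Y k ω : ℂ))) *
      Complex.exp (Complex.I * ((∑ j, Function.update z i t j * Y j ω : ℝ) : ℂ)))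
    Filter.univ_mem
    (Filter.Eventually.of_forall fun t => (integrable_charMoment hm (hY S) _).aestronglyMeasurable)
    (integrable_charMoment hm (hY S) _)
    (integrable_charMoment hm (hY _) _).aestronglyMeasurable
    (Filter.Eventually.of_forall fun ω t _ => ?_) (hY _).norm
    (Filter.Eventually.of_forall fun ω t _ => ?_)
  · have := key.2
    rw [Function.update_eq_self] at this
    exact this
  · rw [norm_mul, norm_exp_I_mul_ofReal, mul_one, norm_prod, norm_prod]
    refine le_of_eq (Finset.prod_congr rfl fun i _ => ?_)
    simp
  · have hsum : ∀ t, ∑ j, Function.update z i t j * Y j ω =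
        t * Y i ω + ∑ j ∈ Finset.univ.erase i, z j * Y j ω := by
      intro t
      rw [← Finset.add_sum_erase _ _ (Finset.mem_univ i), Function.update_self]
      congr 1
      refine Finset.sum_congr rfl fun j hj => ?_
      rw [Function.update_of_ne (Finset.ne_of_mem_erase hj)]
    have h1 : HasDerivAt (fun t : ℝ => ((∑ j, Function.update z i t j * Y j ω : ℝ) : ℂ))
        (Y i ω : ℂ) t := by
      simp_rw [hsum]
      have := ((hasDerivAt_id t).mul_const (Y i ω)).add_const
        (∑ j ∈ Finset.univ.erase i, z j * Y j ω)
      simpa using this.ofReal_comp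
    have h2 := ((h1.const_mul Complex.I).cexp).const_mul (∏ k ∈ S, (Complex.I * (Y k ω : ℂ)))
    refine h2.congr_deriv ?_
    rw [Finset.prod_insert hi]
    ring

/-- Iterated partial derivatives of the logarithm of the characteristic function are given by the
recursion, at all points where the principal branch is smooth. -/
theorem foldr_partialDeriv_log_jointCharFun
    (hY : ∀ S : Finset (Fin ℓ), Integrable (fun ω => ∏ i ∈ S, Y i ω) P) (j : Fin ℓ) :
    ∀ L : List (Fin ℓ), (L ++ [j]).Nodup → ∀ z, charMoment P Y z ∅ ∈ Complex.slitPlane →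
      (L ++ [j]).foldr partialDeriv (fun z => Complex.log (jointCharFun P Y z)) z =
        recCumulant (charMoment P Y z) j (insert j L.toFinset) := by
  have hchar : jointCharFun P Y = fun z => charMoment P Y z ∅ := by
    funext z
    simp [jointCharFun, charMoment]
  intro L
  induction L with
  | nil =>
    intro _ z hz
    simp only [List.nil_append, List.foldr_cons, List.foldr_nil, List.toFinset_nil, partialDeriv,
      hchar]
    have h1 := hasDerivAt_charMoment hY z (Finset.notMem_empty j)
    rw [(h1.clog_real (by rwa [Function.update_eq_self])).deriv, Function.update_eq_self,
      recCumulant_eq]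
    have : ∀ T ∈ (insert j (∅ : Finset (Fin ℓ))).ssubsets, j ∉ T := by
      intro T hT hj
      have := Finset.mem_ssubsets.1 hT
      exact this.2 (Finset.insert_subset hj (Finset.empty_subset _))
    rw [Finset.sum_eq_zero fun T hT => if_neg (this T hT), sub_zero]
  | cons i L ih =>
    intro hnd z hz
    rw [List.cons_append, List.nodup_cons, List.mem_append, List.mem_singleton, not_or] at hnd
    obtain ⟨⟨hiL, hij⟩, hnd⟩ := hnd
    have hcont := (hasDerivAt_charMoment hY z (Finset.notMem_empty i)).continuousAt
    have hev : ∀ᶠ t in nhds (z i), charMoment P Y (Function.update z i t) ∅ ∈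
        Complex.slitPlane := by
      refine hcont.eventually (Complex.isOpen_slitPlane.eventually_mem ?_)
      beta_reduce
      rwa [Function.update_eq_self]
    rw [List.cons_append, List.foldr_cons, partialDeriv, List.toFinset_cons, Finset.insert_comm]
    have hEq : (fun t => (L ++ [j]).foldr partialDeriv
        (fun z => Complex.log (jointCharFun P Y z)) (Function.update z i t)) =ᶠ[nhds (z i)]
        fun t => recCumulant (charMoment P Y (Function.update z i t)) j (insert j L.toFinset) :=
      hev.mono fun t ht => ih hnd _ ht
    rw [hEq.deriv_eq]
    refine (hasDerivAt_recCumulant (fun S hS => hasDerivAt_charMoment hY z hS)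
      (Complex.slitPlane_ne_zero hz) hij _ (Finset.mem_insert_self _ _) ?_).deriv
    simp [hij, hiL]

/-- The joint cumulant is computed by any solution of the moment-cumulant recursion. -/
theorem jointCumulant_eq_of_recursion [IsProbabilityMeasure P] {Y : Fin (ℓ + 1) → Ω → ℝ}
    (hY : ∀ S : Finset (Fin (ℓ + 1)), Integrable (fun ω => ∏ i ∈ S, Y i ω) P)
    {C : Finset (Fin (ℓ + 1)) → ℝ}
    (hC : ∀ S, Fin.last ℓ ∈ S → ∫ ω, ∏ i ∈ S, Y i ω ∂P = ∑ T ∈ S.powerset,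
      if Fin.last ℓ ∈ T then C T * ∫ ω, ∏ i ∈ S \ T, Y i ω ∂P else 0) :
    jointCumulant P Y = (C Finset.univ : ℂ) := by
  have hm : ∀ S, charMoment P Y 0 S =
      Complex.I ^ S.card * ((∫ ω, ∏ i ∈ S, Y i ω ∂P : ℝ) : ℂ) := by
    intro S
    rw [charMoment, ← integral_complex_ofReal, ← integral_const_mul]
    congr 1
    funext ω
    simp [Finset.prod_mul_distrib]
  have h0 : charMoment P Y 0 ∅ = 1 := by simp [hm]
  have hnd := List.nodup_finRange (ℓ + 1)
  rw [jointCumulant, List.finRange_succ_last] at *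
  rw [foldr_partialDeriv_log_jointCharFun hY _ _ hnd 0 (by rw [h0]; exact Complex.one_mem_slitPlane)]
  rw [recCumulant_eq_of_recursion (C := fun S => Complex.I ^ S.card * (C S : ℂ)) h0 ?_ _
    (Finset.mem_insert_self _ _)]
  · have huniv : insert (Fin.last ℓ) ((List.finRange ℓ).map Fin.castSucc).toFinset =
        Finset.univ := by
      ext x
      refine Fin.lastCases ?_ (fun x => ?_) x <;> simp
    rw [huniv, Finset.card_univ, Fintype.card_fin, ← mul_assoc, ← mul_pow]
    simp
  · intro S hS
    rw [hm, hC S hS]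
    push_cast
    rw [Finset.mul_sum]
    refine Finset.sum_congr rfl fun T hT => ?_
    split_ifs
    · rw [hm, ← Finset.card_sdiff_add_card_eq_card (Finset.mem_powerset.1 hT), pow_add]
      push_cast
      ring
    · simp

/-- The joint cumulant vanishes if one of the random variables vanishes almost surely: the
characteristic function does not depend on the corresponding variable. -/
theorem jointCumulant_eq_zero {i : Fin ℓ} (hi : Y i =ᵐ[P] 0) : jointCumulant P Y = 0 := by
  have h1 : ∀ z t, jointCharFun P Y (Function.update z i t) = jointCharFun P Y z := by
    intro z t
    refine integral_congr_ae ?_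
    filter_upwards [hi] with ω hω
    have : ∑ j, Function.update z i t j * Y j ω = ∑ j, z j * Y j ω := by
      refine Finset.sum_congr rfl fun j _ => ?_
      by_cases h : j = i
      · subst h; simp [hω]
      · rw [Function.update_of_ne h]
    rw [this]
  -- derivatives in other variables preserve the independence of the variable `i`, and the derivative
  -- in this variable is then zero
  have h2 : ∀ L : List (Fin ℓ), i ∉ L → ∀ z t,
      L.foldr partialDeriv (fun z => Complex.log (jointCharFun P Y z)) (Function.update z i t) =
      L.foldr partialDeriv (fun z => Complex.log (jointCharFun P Y z)) z := by
    intro L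
    induction L with
    | nil => intro _ z t; simp [h1]
    | cons k L ih =>
      intro hk z t
      rw [List.mem_cons, not_or] at hk
      simp only [List.foldr_cons, partialDeriv, Function.update_of_ne (Ne.symm hk.1)]
      congr 1
      funext s
      rw [Function.update_comm hk.1, ih hk.2]
  have h3 : ∀ L : List (Fin ℓ), L.Nodup → i ∈ L → ∀ z,
      L.foldr partialDeriv (fun z => Complex.log (jointCharFun P Y z)) z = 0 := by
    intro L
    induction L with
    | nil => intro _ h; simp at h
    | cons k L ih =>
      intro hnd hk z
      rw [List.nodup_cons] at hnd
      simp only [List.foldr_cons, partialDeriv]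
      by_cases hik : i = k
      · subst hik
        simp_rw [h2 L hnd.1]
        exact deriv_const _ _
      · have := ih hnd.2 ((List.mem_cons.1 hk).resolve_left hik)
        simp_rw [this]
        exact deriv_const _ _
  rw [jointCumulant, h3 _ (List.nodup_finRange ℓ) (List.mem_finRange i), mul_zero]

end Derivative


/-! ### Changing the index type of the classes -/

section Reindex

open scoped Classical

variable {X : Type*} [MeasurableSpace X] {lam : Measure X} [SigmaFinite lam]

theorem map_comp_equiv_pi {ι κ : Type*} [Fintype ι] [Fintype κ] (e : ι ≃ κ) :
    (Measure.pi fun _ : κ => lam).map (fun y p => y (e p)) = Measure.pi fun _ : ι => lam :=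
  map_comp_pi (fun _ => lam) e fun b => Or.inr ⟨e.symm b, fun q => by
    rw [Equiv.eq_symm_apply]⟩

/-- Reading off the coordinates along an injection preserves null sets. -/
theorem quasiMeasurePreserving_comp_injective {ι κ : Type*} [Fintype ι] [Fintype κ] {u : ι → κ}
    (hu : Function.Injective u) :
    Measure.QuasiMeasurePreserving (fun (y : κ → X) p => y (u p))
      (Measure.pi fun _ : κ => lam) (Measure.pi fun _ : ι => lam) := by
  set e : ι ⊕ {b // b ∉ range u} ≃ κ := Equiv.ofBijective (Sum.elim u Subtype.val) (by
    constructor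
    · refine hu.sumElim Subtype.val_injective fun p b h => b.2 ⟨p, h⟩
    · intro b
      by_cases hb : b ∈ range u
      · obtain ⟨p, rfl⟩ := hb; exact ⟨Sum.inl p, rfl⟩
      · exact ⟨Sum.inr ⟨b, hb⟩, rfl⟩)
  have h1 : MeasurePreserving (fun (y : κ → X) p => y (e p)) (Measure.pi fun _ : κ => lam)
      (Measure.pi fun _ => lam) := ⟨by fun_prop, map_comp_equiv_pi e⟩
  have h2 := measurePreserving_sumPiEquivProdPi
    (fun _ : ι ⊕ {b // b ∉ range u} => lam)
  exact (Measure.quasiMeasurePreserving_fst.comp h2.quasiMeasurePreserving).comp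
    h1.quasiMeasurePreserving

variable {I : Type} [Fintype I] {n : I → ℕ} {f : ∀ i, (Fin (n i) → X) → ℝ} {Q : Type}
  [Fintype Q] {g : Cell n → Q}

omit [Fintype Q] in
theorem measurable_prod_comp (hf : ∀ i, Measurable (f i)) (g : Cell n → Q) :
    Measurable fun y : Q → X => ∏ i, f i (fun k => y (g ⟨i, k⟩)) :=
  Finset.univ.measurable_prod fun i _ => (hf i).comp (by fun_prop)

theorem measurePreserving_quotientKer (hg : Function.Surjective g) :
    MeasurePreserving (fun (y : Q → X) b => y (Setoid.quotientKerEquivOfSurjective g hg b))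
      (Measure.pi fun _ => lam) (Measure.pi fun _ => lam) :=
  ⟨by fun_prop, map_comp_equiv_pi _⟩

theorem diagramIntegral_ker (hf : ∀ i, Measurable (f i)) (hg : Function.Surjective g) :
    diagramIntegral lam f (Setoid.ker g) =
      ∫ y : Q → X, ∏ i, f i (fun k => y (g ⟨i, k⟩)) ∂(Measure.pi fun _ => lam) := by
  rw [diagramIntegral, ← (measurePreserving_quotientKer hg).map_eq,
    integral_map (measurePreserving_quotientKer (lam := lam) hg).measurable.aemeasurable
      (measurable_prod_comp hf _).aestronglyMeasurable]
  rfl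

theorem diagramIntegrable_ker (hf : ∀ i, Measurable (f i)) (hg : Function.Surjective g) :
    DiagramIntegrable lam f (Setoid.ker g) ↔
      Integrable (fun y : Q → X => ∏ i, f i (fun k => y (g ⟨i, k⟩)))
        (Measure.pi fun _ => lam) := by
  rw [DiagramIntegrable, ← (measurePreserving_quotientKer hg).map_eq,
    integrable_map_measure (measurable_prod_comp hf _).aestronglyMeasurable
      (measurePreserving_quotientKer (lam := lam) hg).measurable.aemeasurable]
  rfl

theorem diagramIntegral_eq_zero {i : I} (hi : f i =ᵐ[Measure.pi fun _ => lam] 0)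
    {σ : Setoid (Cell n)} (hσ : NonFlat σ) : diagramIntegral lam f σ = 0 := by
  have hu : Function.Injective fun k : Fin (n i) => Quotient.mk σ ⟨i, k⟩ := by
    intro k l h
    simpa using hσ _ _ (Quotient.exact h) rfl
  refine integral_eq_zero_of_ae ?_
  filter_upwards [(quasiMeasurePreserving_comp_injective (lam := lam) hu).ae_eq_comp hi] with y hy
  exact Finset.prod_eq_zero (Finset.mem_univ i) hy

end Reindex

/-! ### Diagrams that split into two groups of rows -/

section Glue

variable {I I₁ I₂ : Type} {a : I₁ → I} {b : I₂ → I}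

/-- The cells of a family of rows that is split into two families. -/
noncomputable def cellEquiv (hab : Function.Bijective (Sum.elim a b)) (n : I → ℕ) :
    Cell (n ∘ a) ⊕ Cell (n ∘ b) ≃ Cell n :=
  Equiv.ofBijective (Sum.elim (fun p => ⟨a p.1, p.2⟩) (fun p => ⟨b p.1, p.2⟩)) <| by
    constructor
    · rintro (⟨i, k⟩ | ⟨i, k⟩) (⟨j, l⟩ | ⟨j, l⟩) h
      · obtain ⟨h1, h2⟩ := Sigma.mk.inj h
        obtain rfl : i = j := by simpa using hab.1 (a₁ := Sum.inl i) (a₂ := Sum.inl j) h1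
        obtain rfl : k = l := eq_of_heq h2
        rfl
      · have := hab.1 (a₁ := Sum.inl i) (a₂ := Sum.inr j) (Sigma.mk.inj h).1
        simp at this
      · have := hab.1 (a₁ := Sum.inr i) (a₂ := Sum.inl j) (Sigma.mk.inj h).1
        simp at this
      · obtain ⟨h1, h2⟩ := Sigma.mk.inj h
        obtain rfl : i = j := by simpa using hab.1 (a₁ := Sum.inr i) (a₂ := Sum.inr j) h1
        obtain rfl : k = l := eq_of_heq h2
        rfl
    · rintro ⟨i, k⟩
      obtain ⟨i' | i', rfl⟩ := hab.2 i
      · exact ⟨Sum.inl ⟨i', k⟩, rfl⟩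
      · exact ⟨Sum.inr ⟨i', k⟩, rfl⟩

/-- The classes of the juxtaposition of a relation on the first family of rows and a relation on
the second one. -/
noncomputable def glueMap (hab : Function.Bijective (Sum.elim a b)) {n : I → ℕ}
    (σ₁ : Setoid (Cell (n ∘ a))) (σ₂ : Setoid (Cell (n ∘ b))) (p : Cell n) :
    Quotient σ₁ ⊕ Quotient σ₂ :=
  Sum.map (Quotient.mk σ₁) (Quotient.mk σ₂) ((cellEquiv hab n).symm p)

/-- The juxtaposition of a relation on the first family of rows and a relation on the second one. -/
noncomputable def glue (hab : Function.Bijective (Sum.elim a b)) {n : I → ℕ}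
    (σ₁ : Setoid (Cell (n ∘ a))) (σ₂ : Setoid (Cell (n ∘ b))) : Setoid (Cell n) :=
  Setoid.ker (glueMap hab σ₁ σ₂)

/-- The restriction of a relation to the rows in the range of `a`. -/
def restrictRows (a : I₁ → I) {n : I → ℕ} (σ : Setoid (Cell n)) : Setoid (Cell (n ∘ a)) :=
  σ.comap fun p => ⟨a p.1, p.2⟩

/-- The cells of the rows in `R` form a union of classes of `σ`. -/
def RowClosed {n : I → ℕ} (σ : Setoid (Cell n)) (R : Set I) : Prop :=
  ∀ p q, σ p q → p.1 ∈ R → q.1 ∈ R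

variable (hab : Function.Bijective (Sum.elim a b)) {n : I → ℕ}
  {σ₁ : Setoid (Cell (n ∘ a))} {σ₂ : Setoid (Cell (n ∘ b))}

theorem glueMap_left (p : Cell (n ∘ a)) :
    glueMap hab σ₁ σ₂ ⟨a p.1, p.2⟩ = Sum.inl (Quotient.mk σ₁ p) := by
  have : (cellEquiv hab n).symm ⟨a p.1, p.2⟩ = Sum.inl p := by
    rw [Equiv.symm_apply_eq]; rfl
  rw [glueMap, this]; rfl

theorem glueMap_right (p : Cell (n ∘ b)) :
    glueMap hab σ₁ σ₂ ⟨b p.1, p.2⟩ = Sum.inr (Quotient.mk σ₂ p) := by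
  have : (cellEquiv hab n).symm ⟨b p.1, p.2⟩ = Sum.inr p := by
    rw [Equiv.symm_apply_eq]; rfl
  rw [glueMap, this]; rfl

theorem glueMap_surjective : Function.Surjective (glueMap hab σ₁ σ₂ (n := n)) := by
  rintro (c | c)
  · obtain ⟨p, rfl⟩ := Quotient.exists_rep c
    exact ⟨_, glueMap_left hab p⟩
  · obtain ⟨p, rfl⟩ := Quotient.exists_rep c
    exact ⟨_, glueMap_right hab p⟩

include hab in
theorem cell_cases (p : Cell n) :
    (∃ q : Cell (n ∘ a), p = ⟨a q.1, q.2⟩) ∨ ∃ q : Cell (n ∘ b), p = ⟨b q.1, q.2⟩ := by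
  obtain ⟨q | q, rfl⟩ := (cellEquiv hab n).surjective p
  exacts [Or.inl ⟨q, rfl⟩, Or.inr ⟨q, rfl⟩]

theorem glue_left_left (p q : Cell (n ∘ a)) :
    glue hab σ₁ σ₂ ⟨a p.1, p.2⟩ ⟨a q.1, q.2⟩ ↔ σ₁ p q := by
  rw [glue, Setoid.ker_def, glueMap_left, glueMap_left, Sum.inl.injEq]
  exact Quotient.eq

theorem glue_right_right (p q : Cell (n ∘ b)) :
    glue hab σ₁ σ₂ ⟨b p.1, p.2⟩ ⟨b q.1, q.2⟩ ↔ σ₂ p q := by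
  rw [glue, Setoid.ker_def, glueMap_right, glueMap_right, Sum.inr.injEq]
  exact Quotient.eq

theorem not_glue_left_right (p : Cell (n ∘ a)) (q : Cell (n ∘ b)) :
    ¬ glue hab σ₁ σ₂ ⟨a p.1, p.2⟩ ⟨b q.1, q.2⟩ := by
  rw [glue, Setoid.ker_def, glueMap_left, glueMap_right]
  exact Sum.inl_ne_inr

theorem restrictRows_left_glue : restrictRows a (glue hab σ₁ σ₂) = σ₁ :=
  Setoid.ext fun p q => glue_left_left hab p q

theorem restrictRows_right_glue : restrictRows b (glue hab σ₁ σ₂) = σ₂ :=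
  Setoid.ext fun p q => glue_right_right hab p q

theorem glue_restrictRows {σ : Setoid (Cell n)} (hσ : RowClosed σ (range a)) :
    glue hab (restrictRows a σ) (restrictRows b σ) = σ := by
  have hne : ∀ i j, a i ≠ b j := fun i j h => by
    have := hab.1 (a₁ := Sum.inl i) (a₂ := Sum.inr j) h
    simp at this
  have hcross : ∀ (p : Cell (n ∘ a)) (q : Cell (n ∘ b)), ¬ σ ⟨a p.1, p.2⟩ ⟨b q.1, q.2⟩ := by
    intro p q h
    obtain ⟨i, hi⟩ := hσ _ _ h ⟨p.1, rfl⟩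
    exact hne _ _ hi
  refine Setoid.ext fun p q => ?_
  rcases cell_cases hab p with ⟨p, rfl⟩ | ⟨p, rfl⟩ <;>
    rcases cell_cases hab q with ⟨q, rfl⟩ | ⟨q, rfl⟩
  · exact glue_left_left hab p q
  · exact iff_of_false (not_glue_left_right hab p q) (hcross p q)
  · exact iff_of_false (fun h => not_glue_left_right hab q p (Setoid.symm' _ h))
      fun h => hcross q p (σ.symm h)
  · exact glue_right_right hab p q

theorem nonFlat_restrictRows {σ : Setoid (Cell n)} (hσ : NonFlat σ) :
    NonFlat (restrictRows a σ) := by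
  rintro ⟨i, k⟩ ⟨j, l⟩ h hij
  obtain rfl : i = j := hij
  have := hσ _ _ h rfl
  simpa using this

theorem nonFlat_glue (h₁ : NonFlat σ₁) (h₂ : NonFlat σ₂) : NonFlat (glue hab σ₁ σ₂) := by
  have ha : Function.Injective a := fun i j h => by
    simpa using hab.1 (a₁ := Sum.inl i) (a₂ := Sum.inl j) h
  have hb : Function.Injective b := fun i j h => by
    simpa using hab.1 (a₁ := Sum.inr i) (a₂ := Sum.inr j) h
  intro p q hpq hrow
  rcases cell_cases hab p with ⟨p, rfl⟩ | ⟨p, rfl⟩ <;>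
    rcases cell_cases hab q with ⟨q, rfl⟩ | ⟨q, rfl⟩
  · rw [h₁ p q ((glue_left_left hab p q).1 hpq) (ha hrow)]
  · exact absurd hpq (not_glue_left_right hab p q)
  · exact absurd (Setoid.symm' _ hpq) (not_glue_left_right hab q p)
  · rw [h₂ p q ((glue_right_right hab p q).1 hpq) (hb hrow)]

theorem isSingle_glue_left (p : Cell (n ∘ a)) :
    IsSingle (glue hab σ₁ σ₂) ⟨a p.1, p.2⟩ ↔ IsSingle σ₁ p := by
  constructor
  · intro h q hq
    have := h ⟨a q.1, q.2⟩ ((glue_left_left hab p q).2 hq)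
    have := (cellEquiv hab n).injective (a₁ := Sum.inl q) (a₂ := Sum.inl p) this
    simpa using this
  · intro h q hq
    rcases cell_cases hab q with ⟨q, rfl⟩ | ⟨q, rfl⟩
    · rw [h q ((glue_left_left hab p q).1 hq)]
    · exact absurd hq (not_glue_left_right hab p q)

theorem isSingle_glue_right (p : Cell (n ∘ b)) :
    IsSingle (glue hab σ₁ σ₂) ⟨b p.1, p.2⟩ ↔ IsSingle σ₂ p := by
  constructor
  · intro h q hq
    have := h ⟨b q.1, q.2⟩ ((glue_right_right hab p q).2 hq)
    have := (cellEquiv hab n).injective (a₁ := Sum.inr q) (a₂ := Sum.inr p) this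
    simpa using this
  · intro h q hq
    rcases cell_cases hab q with ⟨q, rfl⟩ | ⟨q, rfl⟩
    · exact absurd (Setoid.symm' _ hq) (not_glue_left_right hab q p)
    · rw [h q ((glue_right_right hab p q).1 hq)]

theorem nonFlatTwo_glue_iff :
    NonFlatTwo (glue hab σ₁ σ₂) ↔ NonFlatTwo σ₁ ∧ NonFlatTwo σ₂ := by
  constructor
  · rintro ⟨h1, h2⟩
    refine ⟨⟨?_, fun p hp => h2 _ ((isSingle_glue_left hab p).2 hp)⟩,
      ⟨?_, fun p hp => h2 _ ((isSingle_glue_right hab p).2 hp)⟩⟩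
    · rw [← restrictRows_left_glue hab (σ₁ := σ₁) (σ₂ := σ₂)]
      exact nonFlat_restrictRows h1
    · rw [← restrictRows_right_glue hab (σ₁ := σ₁) (σ₂ := σ₂)]
      exact nonFlat_restrictRows h1
  · rintro ⟨⟨h1, h2⟩, h3, h4⟩
    refine ⟨nonFlat_glue hab h1 h3, fun p hp => ?_⟩
    rcases cell_cases hab p with ⟨p, rfl⟩ | ⟨p, rfl⟩
    · exact h2 p ((isSingle_glue_left hab p).1 hp)
    · exact h4 p ((isSingle_glue_right hab p).1 hp)

/-- The set of rows connected to the row `j` by classes of `σ`: the smallest set of rows containing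
`j` whose cells form a union of classes. -/
def rowComponent (σ : Setoid (Cell n)) (j : I) : Set I :=
  {i | ∀ R, j ∈ R → RowClosed σ R → i ∈ R}

/-- All rows are connected by classes of `σ`: there is no proper nonempty set of rows whose cells
form a union of classes. A diagram without rows is connected. -/
def RowConnected (σ : Setoid (Cell n)) : Prop :=
  ∀ R : Set I, R.Nonempty → RowClosed σ R → R = univ

theorem rowClosed_rowComponent (σ : Setoid (Cell n)) (j : I) :
    RowClosed σ (rowComponent σ j) :=
  fun p q hpq hp R hj hR => hR p q hpq (hp R hj hR)

theorem mem_rowComponent (σ : Setoid (Cell n)) (j : I) : j ∈ rowComponent σ j :=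
  fun _ hj _ => hj

theorem rowConnected_iff {σ : Setoid (Cell n)} (j : I) :
    RowConnected σ ↔ ∀ R : Set I, j ∈ R → RowClosed σ R → R = univ := by
  refine ⟨fun h R hj hR => h R ⟨j, hj⟩ hR, fun h R hne hR => ?_⟩
  by_cases hj : j ∈ R
  · exact h R hj hR
  · have : RowClosed σ Rᶜ := fun p q hpq hp hq => hp (hR q p (σ.symm hpq) hq)
    have := h Rᶜ hj this
    rw [compl_univ_iff] at this
    exact absurd this hne.ne_empty

theorem rowComponent_glue (h : RowConnected σ₁) (j : I₁) :
    rowComponent (glue hab σ₁ σ₂) (a j) = range a := by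
  have hne : ∀ i j, a i ≠ b j := fun i j h => by
    have := hab.1 (a₁ := Sum.inl i) (a₂ := Sum.inr j) h
    simp at this
  refine Subset.antisymm (fun i hi => hi _ ⟨j, rfl⟩ ?_) ?_
  · intro p q hpq hp
    rcases cell_cases hab q with ⟨q, rfl⟩ | ⟨q, rfl⟩
    · exact ⟨q.1, rfl⟩
    · rcases cell_cases hab p with ⟨p, rfl⟩ | ⟨p, rfl⟩
      · exact absurd hpq (not_glue_left_right hab p q)
      · obtain ⟨i, hi⟩ := hp
        exact absurd hi (hne _ _)
  · rintro _ ⟨i, rfl⟩ R hj hR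
    have := h (a ⁻¹' R) ⟨j, hj⟩ fun p q hpq hp => hR _ _ ((glue_left_left hab p q).2 hpq) hp
    have hi : i ∈ a ⁻¹' R := this ▸ mem_univ i
    exact hi

theorem rowConnected_restrictRows (ha : Function.Injective a) {σ : Setoid (Cell n)} {j : I₁}
    (h : rowComponent σ (a j) = range a) : RowConnected (restrictRows a σ) := by
  rw [rowConnected_iff j]
  intro R hj hR
  refine eq_univ_of_forall fun i => ?_
  have hi : a i ∈ rowComponent σ (a j) := h ▸ mem_range_self i
  have hcl := rowClosed_rowComponent σ (a j)
  rw [h] at hcl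
  have : RowClosed σ (a '' R) := by
    rintro ⟨_, k⟩ ⟨i₂, l⟩ hpq ⟨i₁, hi₁, rfl⟩
    obtain ⟨i₂, rfl⟩ := hcl _ _ hpq ⟨i₁, rfl⟩
    exact ⟨i₂, hR ⟨i₁, k⟩ ⟨i₂, l⟩ hpq hi₁, rfl⟩
  obtain ⟨i', hi', e⟩ := hi _ (mem_image_of_mem a hj) this
  exact ha e ▸ hi'

end Glue

section GlueIntegral

open scoped Classical

variable {X : Type*} [MeasurableSpace X] {lam : Measure X} [SigmaFinite lam]
  {I I₁ I₂ : Type} [Fintype I] [Fintype I₁] [Fintype I₂] {a : I₁ → I} {b : I₂ → I}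
  (hab : Function.Bijective (Sum.elim a b)) {n : I → ℕ}
  {f : ∀ i, (Fin (n i) → X) → ℝ} (hf : ∀ i, Measurable (f i))
  {σ₁ : Setoid (Cell (n ∘ a))} {σ₂ : Setoid (Cell (n ∘ b))}

omit [MeasurableSpace X] in
theorem prod_glueMap (y : Quotient σ₁ ⊕ Quotient σ₂ → X) :
    ∏ i, f i (fun k => y (glueMap hab σ₁ σ₂ ⟨i, k⟩)) =
      (∏ i, f (a i) (fun k => y (Sum.inl (Quotient.mk σ₁ ⟨i, k⟩)))) *
        ∏ i, f (b i) (fun k => y (Sum.inr (Quotient.mk σ₂ ⟨i, k⟩))) := by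
  rw [← hab.prod_comp, Fintype.prod_sum_type]
  congr 1
  · refine Finset.prod_congr rfl fun i _ => ?_
    congr 1
    funext k
    exact congrArg y (glueMap_left hab ⟨i, k⟩)
  · refine Finset.prod_congr rfl fun i _ => ?_
    congr 1
    funext k
    exact congrArg y (glueMap_right hab ⟨i, k⟩)

include hf

/-- The integrals of diagrams are multiplicative. -/
theorem diagramIntegral_glue :
    diagramIntegral lam f (glue hab σ₁ σ₂) =
      diagramIntegral lam (fun i => f (a i)) σ₁ * diagramIntegral lam (fun i => f (b i)) σ₂ := by
  rw [glue, diagramIntegral_ker hf (glueMap_surjective hab)]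
  simp_rw [prod_glueMap]
  have h := measurePreserving_sumPiEquivProdPi (fun _ : Quotient σ₁ ⊕ Quotient σ₂ => lam)
  rw [diagramIntegral, diagramIntegral, ← integral_prod_mul, ← h.integral_comp']
  rfl

theorem integrable_prod_of_diagramIntegrable_glue
    (hint : DiagramIntegrable lam f (glue hab σ₁ σ₂)) :
    Integrable (fun z : (Quotient σ₁ → X) × (Quotient σ₂ → X) =>
      (∏ i, f (a i) (fun k => z.1 (Quotient.mk σ₁ ⟨i, k⟩))) *
        ∏ i, f (b i) (fun k => z.2 (Quotient.mk σ₂ ⟨i, k⟩)))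
      ((Measure.pi fun _ => lam).prod (Measure.pi fun _ => lam)) := by
  rw [glue, diagramIntegrable_ker hf (glueMap_surjective hab)] at hint
  simp_rw [prod_glueMap] at hint
  have h := measurePreserving_sumPiEquivProdPi (fun _ : Quotient σ₁ ⊕ Quotient σ₂ => lam)
  rw [← h.integrable_comp_emb (MeasurableEquiv.measurableEmbedding _)]
  exact hint

end GlueIntegral


/-! ### The moment-cumulant recursion for diagrams -/

section DiagramRecursion

open scoped Classical

variable {X : Type*} [MeasurableSpace X] {lam : Measure X} [SigmaFinite lam]
  {I : Type} {n : I → ℕ} {f : ∀ i, (Fin (n i) → X) → ℝ}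

/-- The sum of the integrals of the diagrams without one-element classes on the rows in `S`. -/
noncomputable def diagramMoment (lam : Measure X) (f : ∀ i, (Fin (n i) → X) → ℝ)
    (S : Finset I) : ℝ :=
  ∑ σ : Setoid (Cell fun i : S => n i) with NonFlatTwo σ, diagramIntegral lam (fun i : S => f i) σ

/-- The sum of the integrals of the connected diagrams without one-element classes on the rows
in `S`. -/
noncomputable def diagramCumulant (lam : Measure X) (f : ∀ i, (Fin (n i) → X) → ℝ)
    (S : Finset I) : ℝ :=
  ∑ σ : Setoid (Cell fun i : S => n i) with NonFlatTwo σ ∧ RowConnected σ,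
    diagramIntegral lam (fun i : S => f i) σ

theorem bijective_inclusion_sdiff {S T : Finset I} (hT : T ⊆ S) :
    Function.Bijective (Sum.elim (fun i : T => (⟨i, hT i.2⟩ : S))
      (fun i : ↥(S \ T) => (⟨i, Finset.sdiff_subset i.2⟩ : S))) := by
  constructor
  · rintro (i | i) (j | j) h
    · exact congrArg _ (Subtype.ext (Subtype.mk.inj h))
    · have : (i : I) = j := congrArg Subtype.val h
      exact absurd (this ▸ i.2) (Finset.mem_sdiff.1 j.2).2
    · have : (i : I) = j := congrArg Subtype.val h
      exact absurd (this.symm ▸ j.2) (Finset.mem_sdiff.1 i.2).2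
    · exact congrArg _ (Subtype.ext (Subtype.mk.inj h))
  · intro i
    by_cases hi : (i : I) ∈ T
    · exact ⟨Sum.inl ⟨i, hi⟩, rfl⟩
    · exact ⟨Sum.inr ⟨i, Finset.mem_sdiff.2 ⟨i.2, hi⟩⟩, rfl⟩

/-- A diagram is the juxtaposition of the connected diagram on the component of the row `j` and an
arbitrary diagram on the remaining rows. -/
theorem diagramMoment_eq_sum (hf : ∀ i, Measurable (f i)) {j : I} {S : Finset I} (hj : j ∈ S) :
    diagramMoment lam f S = ∑ T ∈ S.powerset,
      if j ∈ T then diagramCumulant lam f T * diagramMoment lam f (S \ T) else 0 := by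
  -- `comp σ` is the set of the rows in `S` that are connected to the row `j`; the diagrams are
  -- grouped by its value `T`
  set comp : Setoid (Cell fun i : S => n i) → Finset I := fun σ =>
    S.filter fun i => ∃ h : i ∈ S, (⟨i, h⟩ : S) ∈ rowComponent σ ⟨j, hj⟩
  have hmaps : ∀ σ ∈ Finset.univ.filter fun σ : Setoid (Cell fun i : S => n i) => NonFlatTwo σ,
      comp σ ∈ S.powerset.filter fun T => j ∈ T := fun σ _ =>
    Finset.mem_filter.2 ⟨Finset.mem_powerset.2 (Finset.filter_subset _ _),
      Finset.mem_filter.2 ⟨hj, hj, mem_rowComponent _ _⟩⟩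
  rw [diagramMoment, ← Finset.sum_filter, ← Finset.sum_fiberwise_of_maps_to hmaps]
  refine Finset.sum_congr rfl fun T hT => ?_
  obtain ⟨hTS, hjT⟩ := Finset.mem_filter.1 hT
  replace hTS := Finset.mem_powerset.1 hTS
  set a : T → S := fun i => ⟨i, hTS i.2⟩
  set b : ↥(S \ T) → S := fun i => ⟨i, Finset.sdiff_subset i.2⟩
  have hab : Function.Bijective (Sum.elim a b) := bijective_inclusion_sdiff hTS
  have hra : range a = {i : S | (i : I) ∈ T} := by
    ext i
    exact ⟨by rintro ⟨k, rfl⟩; exact k.2, fun hi => ⟨⟨i, hi⟩, rfl⟩⟩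
  have ha : Function.Injective a := fun i k h => Subtype.ext (Subtype.mk.inj h)
  have hcomp : ∀ σ, comp σ = T ↔ rowComponent σ (a ⟨j, hjT⟩) = range a := by
    intro σ
    rw [hra]
    constructor
    · intro h
      ext i
      have h' : (i : I) ∈ comp σ ↔ (i : I) ∈ T := by rw [h]
      rw [mem_ofPred_eq, ← h', Finset.mem_filter]
      exact ⟨fun hi => ⟨i.2, i.2, hi⟩, fun hi => hi.2.2⟩
    · intro h
      ext i
      rw [Finset.mem_filter]
      constructor
      · rintro ⟨-, hi, hi'⟩
        have : (⟨i, hi⟩ : S) ∈ rowComponent σ (a ⟨j, hjT⟩) := hi'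
        rw [h] at this
        exact this
      · intro hi
        refine ⟨hTS hi, hTS hi, ?_⟩
        change (⟨i, hTS hi⟩ : S) ∈ rowComponent σ (a ⟨j, hjT⟩)
        rw [h]
        exact hi
  rw [diagramCumulant, diagramMoment, Finset.sum_mul_sum, ← Finset.sum_product']
  refine Finset.sum_bij' (fun σ _ => (restrictRows a σ, restrictRows b σ))
    (fun z _ => glue hab z.1 z.2) ?_ ?_ ?_ ?_ ?_
  · intro σ hσ
    simp only [Finset.mem_filter, Finset.mem_univ, true_and] at hσ
    obtain ⟨h2, hc⟩ := hσ
    rw [hcomp] at hc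
    have hcl : RowClosed σ (range a) := hc ▸ rowClosed_rowComponent σ _
    rw [← glue_restrictRows hab hcl, nonFlatTwo_glue_iff] at h2
    simp only [Finset.mem_product, Finset.mem_filter, Finset.mem_univ, true_and]
    exact ⟨⟨h2.1, rowConnected_restrictRows ha hc⟩, h2.2⟩
  · rintro ⟨σ₁, σ₂⟩ hz
    simp only [Finset.mem_product, Finset.mem_filter, Finset.mem_univ, true_and] at hz
    simp only [Finset.mem_filter, Finset.mem_univ, true_and]
    exact ⟨(nonFlatTwo_glue_iff hab).2 ⟨hz.1.1, hz.2⟩,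
      (hcomp _).2 (rowComponent_glue hab hz.1.2 ⟨j, hjT⟩)⟩
  · intro σ hσ
    simp only [Finset.mem_filter, Finset.mem_univ, true_and] at hσ
    have hc := (hcomp σ).1 hσ.2
    exact glue_restrictRows hab (hc ▸ rowClosed_rowComponent σ _)
  · rintro ⟨σ₁, σ₂⟩ _
    exact Prod.ext (restrictRows_left_glue hab) (restrictRows_right_glue hab)
  · intro σ hσ
    simp only [Finset.mem_filter, Finset.mem_univ, true_and] at hσ
    have hc := (hcomp σ).1 hσ.2
    have hcl : RowClosed σ (range a) := hc ▸ rowClosed_rowComponent σ _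
    conv_lhs => rw [← glue_restrictRows hab hcl]
    exact diagramIntegral_glue hab (fun i : S => hf i)

end DiagramRecursion

/-! ### Subfamilies -/

section Subfamily

open scoped Classical

variable {X : Type*} [MeasurableSpace X] {lam : Measure X} [SigmaFinite lam]

theorem not_ae_eq_zero_prod {I : Type} [Fintype I] {n : I → ℕ} {f : ∀ i, (Fin (n i) → X) → ℝ}
    (h0 : ∀ i, ¬ f i =ᵐ[Measure.pi fun _ => lam] 0) :
    ¬ (fun y : Cell n → X => ∏ i, f i (fun k => y ⟨i, k⟩)) =ᵐ[Measure.pi fun _ => lam] 0 := by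
  intro h
  have h1 : (Measure.pi fun i => Measure.pi fun _ : Fin (n i) => lam)
      (pi univ fun i => {x | f i x ≠ 0}) = 0 := by
    have hc : Measure.QuasiMeasurePreserving
        (fun (x : ∀ i, Fin (n i) → X) (p : Cell n) => x p.1 p.2)
        (Measure.pi fun i => Measure.pi fun _ : Fin (n i) => lam)
        (Measure.pi fun _ => lam) := by
      refine ⟨by fun_prop, ?_⟩
      rw [← pi_map_curry (fun _ : Cell n => lam), Measure.map_map (by fun_prop) (by fun_prop)]
      exact (Measure.map_id (μ := Measure.pi fun _ : Cell n => lam)).le.absolutelyContinuous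
    refine measure_mono_null ?_ (hc.ae h)
    intro x hx hx'
    have hx'' : ∏ i, f i (x i) = 0 := hx'
    exact Finset.prod_ne_zero_iff.2 (fun i _ => hx i trivial) hx''
  rw [Measure.pi_pi, Finset.prod_eq_zero_iff] at h1
  obtain ⟨i, -, hi⟩ := h1
  exact h0 i hi

/-- If no function vanishes almost everywhere, the integrability of all diagrams passes to
subfamilies of rows: a diagram on a subfamily is completed by one-element classes. -/
theorem diagramIntegrable_of_glue {I I₁ I₂ : Type} [Fintype I] [Fintype I₁] [Fintype I₂]
    {a : I₁ → I} {b : I₂ → I} (hab : Function.Bijective (Sum.elim a b)) {n : I → ℕ}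
    {f : ∀ i, (Fin (n i) → X) → ℝ} (hf : ∀ i, Measurable (f i))
    (h0 : ∀ i, ¬ f i =ᵐ[Measure.pi fun _ => lam] 0)
    (hd : ∀ σ : Setoid (Cell n), NonFlat σ → DiagramIntegrable lam f σ)
    {σ₁ : Setoid (Cell (n ∘ a))} (hσ₁ : NonFlat σ₁) :
    DiagramIntegrable lam (fun i => f (a i)) σ₁ := by
  set σ₂ : Setoid (Cell (n ∘ b)) := Setoid.ker id
  have hσ₂ : NonFlat σ₂ := fun p q h _ => h
  have hint := integrable_prod_of_diagramIntegrable_glue hab hf (hd _ (nonFlat_glue hab hσ₁ hσ₂))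
  have h2 : ¬ (fun y : Quotient σ₂ → X =>
      ∏ i, f (b i) (fun k => y (Quotient.mk σ₂ ⟨i, k⟩))) =ᵐ[Measure.pi fun _ => lam] 0 := by
    intro h
    refine not_ae_eq_zero_prod (f := fun i => f (b i)) (fun i => h0 (b i)) ?_
    have hp := measurePreserving_quotientKer (lam := lam) (g := (id : Cell (n ∘ b) → _))
      Function.surjective_id
    exact hp.quasiMeasurePreserving.ae_eq_comp h
  -- by Fubini, the diagram on the subfamily is integrable as soon as the product over the other rows
  -- is nonzero at one point of a set of full measure
  have h3 := hint.prod_left_ae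
  by_contra hcon
  refine h2 ?_
  filter_upwards [h3] with y hy
  by_contra hne
  exact hcon ((integrable_mul_const_iff (IsUnit.mk0 _ hne) _).1 hy)

end Subfamily


/-! ### Partitions and equivalence relations -/

section Partition

variable {ℓ : ℕ} {n : Fin ℓ → ℕ}

/-- The block of a partition that contains a given cell. -/
def blockMap (σ : RowPartition n) (p : Cell n) : {B // B ∈ σ.parts} :=
  ⟨σ.part p, σ.part_mem.2 (Finset.mem_univ p)⟩

/-- The equivalence relation whose classes are the blocks of a partition. -/
def partitionSetoid (σ : RowPartition n) : Setoid (Cell n) := Setoid.ker (blockMap σ)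

theorem blockMap_surjective (σ : RowPartition n) : Function.Surjective (blockMap σ) := by
  rintro ⟨B, hB⟩
  obtain ⟨p, hp⟩ := σ.nonempty_of_mem_parts hB
  exact ⟨p, Subtype.ext (σ.part_eq_of_mem hB hp)⟩

theorem partitionSetoid_iff {σ : RowPartition n} {p q : Cell n} :
    partitionSetoid σ p q ↔ σ.part p = σ.part q := by
  rw [partitionSetoid, Setoid.ker_def, blockMap, blockMap, Subtype.mk.injEq]

theorem partitionSetoid_iff_exists {σ : RowPartition n} {p q : Cell n} :
    partitionSetoid σ p q ↔ ∃ B ∈ σ.parts, p ∈ B ∧ q ∈ B := by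
  rw [partitionSetoid_iff]
  constructor
  · intro h
    refine ⟨σ.part p, σ.part_mem.2 (Finset.mem_univ p), σ.mem_part_self.2 (Finset.mem_univ p), ?_⟩
    rw [h]
    exact σ.mem_part_self.2 (Finset.mem_univ q)
  · rintro ⟨B, hB, hp, hq⟩
    rw [σ.part_eq_of_mem hB hp, σ.part_eq_of_mem hB hq]

theorem partitionSetoid_bijective :
    Function.Bijective (partitionSetoid : RowPartition n → Setoid (Cell n)) := by
  classical
  constructor
  · intro σ τ h
    have hmem : ∀ (ρ : RowPartition n) (p q : Cell n), q ∈ ρ.part p ↔ partitionSetoid ρ p q := by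
      intro ρ p q
      rw [partitionSetoid_iff]
      constructor
      · intro hq
        exact (ρ.part_eq_of_mem (ρ.part_mem.2 (Finset.mem_univ p)) hq).symm
      · intro hq
        rw [hq]
        exact ρ.mem_part_self.2 (Finset.mem_univ q)
    have hpart : ∀ p, σ.part p = τ.part p := fun p => by
      ext q
      rw [hmem, hmem, h]
    have hparts : ∀ (ρ : RowPartition n) B, B ∈ ρ.parts ↔ ∃ p, ρ.part p = B := by
      intro ρ B
      constructor
      · intro hB
        obtain ⟨p, hp⟩ := ρ.nonempty_of_mem_parts hB
        exact ⟨p, ρ.part_eq_of_mem hB hp⟩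
      · rintro ⟨p, rfl⟩
        exact ρ.part_mem.2 (Finset.mem_univ p)
    ext B
    rw [hparts, hparts]
    simp_rw [hpart]
  · intro s
    refine ⟨Finpartition.ofSetoid s, Setoid.ext fun p q => ?_⟩
    rw [partitionSetoid_iff_exists]
    constructor
    · rintro ⟨B, hB, hp, hq⟩
      have := (Finpartition.ofSetoid s).part_eq_of_mem hB hp
      rw [← this] at hq
      exact Finpartition.mem_part_ofSetoid_iff_rel.1 hq
    · intro h
      exact ⟨_, (Finpartition.ofSetoid s).part_mem.2 (Finset.mem_univ p),
        Finpartition.mem_part_ofSetoid_iff_rel.2 (s.refl p),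
        Finpartition.mem_part_ofSetoid_iff_rel.2 h⟩

theorem nonFlat_partitionSetoid {σ : RowPartition n} :
    NonFlat (partitionSetoid σ) ↔ IsNonFlat σ := by
  constructor
  · intro h B hB i
    refine Finset.card_le_one.2 fun p hp q hq => ?_
    rw [Finset.mem_filter] at hp hq
    exact h p q (partitionSetoid_iff_exists.2 ⟨B, hB, hp.1, hq.1⟩) (hp.2.trans hq.2.symm)
  · intro h p q hpq hrow
    obtain ⟨B, hB, hp, hq⟩ := partitionSetoid_iff_exists.1 hpq
    exact Finset.card_le_one.1 (h B hB q.1) p (Finset.mem_filter.2 ⟨hp, hrow⟩) q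
      (Finset.mem_filter.2 ⟨hq, rfl⟩)

theorem nonFlatTwo_partitionSetoid {σ : RowPartition n} :
    NonFlatTwo (partitionSetoid σ) ↔ IsNonFlatTwo σ := by
  refine and_congr nonFlat_partitionSetoid ⟨fun h B hB => ?_, fun h p hp => ?_⟩
  · obtain ⟨p, hp⟩ := σ.nonempty_of_mem_parts hB
    have := h p
    simp only [IsSingle, not_forall] at this
    obtain ⟨q, hq, hne⟩ := this
    refine Finset.one_lt_card.2 ⟨q, ?_, p, hp, hne⟩
    rw [partitionSetoid_iff, σ.part_eq_of_mem hB hp] at hq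
    rw [hq]
    exact σ.mem_part_self.2 (Finset.mem_univ q)
  · obtain ⟨q, hq, q', hq', hne⟩ := Finset.one_lt_card.1
      (h (σ.part p) (σ.part_mem.2 (Finset.mem_univ p)))
    have hs : ∀ q ∈ σ.part p, q = p := fun q hq =>
      hp q (partitionSetoid_iff_exists.2 ⟨_, σ.part_mem.2 (Finset.mem_univ p),
        σ.mem_part_self.2 (Finset.mem_univ p), hq⟩)
    exact hne ((hs q hq).trans (hs q' hq').symm)

theorem rowConnected_partitionSetoid (hℓ : 1 ≤ ℓ) {σ : RowPartition n} :
    RowConnected (partitionSetoid σ) ↔ (rowSetoid σ).classes.ncard = 1 := by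
  constructor
  · intro h
    have hall : ∀ i k, rowSetoid σ i k := by
      intro i k
      have hR := h {k | rowSetoid σ i k} ⟨i, (rowSetoid σ).refl i⟩ (by
        intro p q hpq hp
        obtain ⟨B, hB, hpB, hqB⟩ := partitionSetoid_iff_exists.1 hpq
        exact (rowSetoid σ).trans hp fun r hr => hr B hB p hpB q hqB)
      have : k ∈ {k | rowSetoid σ i k} := hR ▸ mem_univ k
      exact this
    rw [ncard_eq_one]
    refine ⟨univ, Subset.antisymm ?_ ?_⟩
    · rintro _ ⟨i, rfl⟩
      exact eq_univ_of_forall fun k => hall k i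
    · rintro _ rfl
      exact ⟨⟨0, hℓ⟩, (eq_univ_of_forall fun k => hall k _).symm⟩
  · intro h R hne hR
    obtain ⟨c, hc⟩ := ncard_eq_one.1 h
    have hcl : ∀ i, {x | rowSetoid σ x i} = c := fun i => by
      have : {x | rowSetoid σ x i} ∈ (rowSetoid σ).classes := ⟨i, rfl⟩
      rwa [hc] at this
    obtain ⟨i, hi⟩ := hne
    refine eq_univ_of_forall fun k => ?_
    have hki : rowSetoid σ k i := by
      have : k ∈ {x | rowSetoid σ x k} := (rowSetoid σ).refl k
      rw [hcl k, ← hcl i] at this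
      exact this
    have := hki (Setoid.ker (· ∈ R)) (by
      intro B hB p hp q hq
      have hpq : partitionSetoid σ p q := partitionSetoid_iff_exists.2 ⟨B, hB, hp, hq⟩
      exact propext ⟨hR p q hpq, hR q p ((partitionSetoid σ).symm hpq)⟩)
    have hiff : (k ∈ R) = (i ∈ R) := this
    rw [hiff]
    exact hi

variable {X : Type*} [MeasurableSpace X] {lam : Measure X} [SigmaFinite lam]
  {f : ∀ i, (Fin (n i) → X) → ℝ}

theorem integral_collapse (hf : ∀ i, Measurable (f i)) (σ : RowPartition n) :
    ∫ y, collapse σ (tensor f) y ∂(blockMeasure lam σ) =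
      diagramIntegral lam f (partitionSetoid σ) :=
  (diagramIntegral_ker hf (blockMap_surjective σ)).symm

theorem diagramIntegrable_partitionSetoid (hf : ∀ i, Measurable (f i)) {σ : RowPartition n}
    (h : ∫⁻ y, ENNReal.ofReal (collapse σ (tensor fun i x => |f i x|) y) ∂(blockMeasure lam σ) < ∞) :
    DiagramIntegrable lam f (partitionSetoid σ) := by
  refine (diagramIntegrable_ker hf (blockMap_surjective σ)).2
    ⟨(measurable_prod_comp hf _).aestronglyMeasurable, ?_⟩
  refine lt_of_eq_of_lt (lintegral_congr fun y => ?_) h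
  rw [Real.enorm_eq_ofReal_abs, Finset.abs_prod]
  rfl

end Partition

/-! ### The joint cumulant of multiple integrals -/

section Main

variable {Ω X : Type*} [MeasurableSpace Ω] [MeasurableSpace X] {P : Measure Ω}
  {lam : Measure X} [SigmaFinite lam] {η : Ω → Measure X}

open scoped Classical in
theorem diagramCumulant_univ {I : Type} [Fintype I] [Nonempty I] {n : I → ℕ}
    {f : ∀ i, (Fin (n i) → X) → ℝ} (hf : ∀ i, Measurable (f i)) :
    diagramCumulant lam f Finset.univ =
      ∑ σ : Setoid (Cell n) with NonFlatTwo σ ∧ RowConnected σ, diagramIntegral lam f σ := by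
  obtain ⟨j⟩ := ‹Nonempty I›
  set a : ↥(Finset.univ : Finset I) → I := Subtype.val
  set b : Empty → I := Empty.elim
  have ha : Function.Injective a := Subtype.val_injective
  have hab : Function.Bijective (Sum.elim a b) :=
    ⟨ha.sumElim (fun i => i.elim) fun _ i => i.elim,
      fun i => ⟨Sum.inl ⟨i, Finset.mem_univ i⟩, rfl⟩⟩
  have hra : range a = univ := eq_univ_of_forall fun i => ⟨⟨i, Finset.mem_univ i⟩, rfl⟩
  have hcl : ∀ σ : Setoid (Cell n), RowClosed σ (range a) := fun σ p q _ _ => hra ▸ mem_univ _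
  have hE : ∀ σ₂ : Setoid (Cell (n ∘ b)), NonFlatTwo σ₂ := fun σ₂ =>
    ⟨fun p => p.1.elim, fun p => p.1.elim⟩
  symm
  refine Finset.sum_bij' (fun σ _ => restrictRows a σ) (fun σ₁ _ => glue hab σ₁ ⊥) ?_ ?_ ?_ ?_ ?_
  · intro σ hσ
    rw [Finset.mem_filter] at hσ ⊢
    obtain ⟨-, h2, hc⟩ := hσ
    refine ⟨Finset.mem_univ _, ?_, ?_⟩
    · rw [← glue_restrictRows hab (hcl σ)] at h2
      exact ((nonFlatTwo_glue_iff hab).1 h2).1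
    · refine rowConnected_restrictRows ha (j := ⟨j, Finset.mem_univ j⟩) ?_
      rw [hra]
      exact hc _ ⟨_, mem_rowComponent _ _⟩ (rowClosed_rowComponent _ _)
  · intro σ₁ hσ
    rw [Finset.mem_filter] at hσ ⊢
    obtain ⟨-, h2, hc⟩ := hσ
    refine ⟨Finset.mem_univ _, (nonFlatTwo_glue_iff hab).2 ⟨h2, hE _⟩, ?_⟩
    rw [rowConnected_iff j]
    intro R hj hR
    have h := rowComponent_glue hab (σ₂ := ⊥) hc ⟨j, Finset.mem_univ j⟩
    rw [hra] at h
    exact eq_univ_of_forall fun i => (h ▸ mem_univ i : i ∈ rowComponent (glue hab σ₁ ⊥)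
      (a ⟨j, Finset.mem_univ j⟩)) R hj hR
  · intro σ _
    have hsub : (⊥ : Setoid (Cell (n ∘ b))) = restrictRows b σ := Setoid.ext fun p => p.1.elim
    rw [hsub]
    exact glue_restrictRows hab (hcl σ)
  · intro σ₁ _
    exact restrictRows_left_glue hab
  · intro σ _
    conv_lhs => rw [← glue_restrictRows hab (hcl σ), diagramIntegral_glue hab hf]
    have h1 : diagramIntegral lam (fun i => f (b i)) (restrictRows b σ) = 1 := by
      have : IsEmpty (Quotient (restrictRows b σ)) :=
        ⟨fun c => Quotient.inductionOn c fun p => p.1.elim⟩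
      rw [diagramIntegral, Measure.pi_of_empty _ (fun c => isEmptyElim c)]
      simp
    rw [h1, mul_one]

theorem poissonLaw_singleton_top {c : ℝ≥0∞} (hc : c ≠ ∞) : poissonLaw c {∞} = 0 := by
  rw [poissonLaw, if_neg hc, Measure.map_apply (by fun_prop) (measurableSet_singleton _)]
  have : (fun k : ℕ => (k : ℝ≥0∞)) ⁻¹' {∞} = ∅ := by
    ext k; simp
  rw [this, measure_empty]

/-- Almost surely, the realizations of a Poisson process are those of a process that splits into
zero-one measures and is finite on an exhausting sequence of sets. -/
theorem exists_isSplitPoisson (hη : IsPoissonProcess η lam P) :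
    ∃ (D : ℕ → Set X) (E : Ω → Type) (ν : ∀ ω, E ω → Measure X), IsSplitPoisson P lam D ν ∧
      ∀ᵐ ω ∂P, η ω = Measure.sum (ν ω) := by
  classical
  set D := spanningSets lam
  have hDm := measurableSet_spanningSets lam
  set G : Set Ω := {ω | ∀ k, η ω (D k) ≠ ∞}
  have hmeas : ∀ B, MeasurableSet B → Measurable fun ω => η ω B := fun B hB =>
    Measure.measurable_measure.1 hη.measurable B hB
  have hG : MeasurableSet G := by
    have : G = ⋂ k, {ω | η ω (D k) ≠ ∞} := by ext; simp [G]
    rw [this]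
    exact MeasurableSet.iInter fun k => (hmeas _ (hDm k) (measurableSet_singleton ∞)).compl
  have hGae : ∀ᵐ ω ∂P, ω ∈ G := by
    refine ae_all_iff.2 fun k => ?_
    have h1 : P.map (fun ω => η ω (D k)) {∞} = 0 := by
      rw [hη.map_eq _ (hDm k)]
      exact poissonLaw_singleton_top (measure_spanningSets_lt_top lam k).ne
    rw [Measure.map_apply (hmeas _ (hDm k)) (measurableSet_singleton _)] at h1
    rw [ae_iff]
    simpa using! h1
  -- on the null set where some `D k` has infinite mass, the realization is replaced by zero
  set η' : Ω → Measure X := fun ω => if ω ∈ G then η ω else 0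
  have hη' : ∀ᵐ ω ∂P, η ω = η' ω := hGae.mono fun ω hω => (if_pos hω).symm
  have hrep : ∀ ω, ∃ (E : Type) (_ : Countable E) (ν : E → Measure X), (∀ e, IsZeroOne (ν e)) ∧
      Measure.sum ν = η' ω := by
    intro ω
    by_cases hω : ω ∈ G
    · have := hη.sigmaFinite ω
      obtain ⟨E, hE, ν, h1, h2⟩ := exists_sum_isZeroOne (η ω) (hη.integerValued ω)
      exact ⟨E, hE, ν, h1, h2.trans (if_pos hω).symm⟩
    · refine ⟨Empty, inferInstance, fun e => e.elim, fun e => e.elim, ?_⟩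
      rw [Measure.sum_of_isEmpty]
      exact (if_neg hω).symm
  choose E hE ν h01 hsum using hrep
  refine ⟨D, E, ν, ⟨hDm, monotone_spanningSets lam, iUnion_spanningSets lam,
    fun k => (measure_spanningSets_lt_top lam k).ne, hE, h01, ?_, ?_, ?_, ?_⟩, ?_⟩
  · intro ω k
    rw [hsum]
    by_cases hω : ω ∈ G
    · simp only [η', if_pos hω]
      exact hω k
    · simp [η', if_neg hω]
  · simp_rw [hsum]
    exact Measurable.ite hG hη.measurable measurable_const
  · intro B hB
    simp_rw [hsum]
    rw [← hη.map_eq B hB]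
    exact Measure.map_congr (hη'.mono fun ω hω => by simp only [hω])
  · intro k B hB hd
    simp_rw [hsum]
    exact (hη.indep k B hB hd).congr fun i => hη'.mono fun ω hω => by simp only [hω]
  · exact hη'.mono fun ω hω => hω.trans (hsum ω).symm

theorem IsSplitPoisson.ae_wienerIto_eq {D : ℕ → Set X} {E : Ω → Type} {ν : ∀ ω, E ω → Measure X}
    (h : IsSplitPoisson P lam D ν) {m : ℕ} {g : (Fin m → X) → ℝ} (hg : IsL1Symm lam g) :
    ∀ᵐ ω ∂P, wienerIto lam g (Measure.sum (ν ω)) = splitIntegral lam (ν ω) g := by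
  filter_upwards [h.ae_integrable hg.measurable hg.integrable] with ω hω
  have := h.countable ω
  have : SigmaFinite (Measure.sum (ν ω)) :=
    ⟨⟨⟨D, fun _ => trivial, fun k => (h.ne_top ω k).lt_top, h.iUnion⟩⟩⟩
  exact wienerIto_eq_sum (h.isZeroOne ω) hω

/-- By the Mecke formula, a null function vanishes almost everywhere with respect to almost every
mixed factorial measure. -/
theorem IsSplitPoisson.ae_splitIntegral_eq_zero {D : ℕ → Set X} {E : Ω → Type}
    {ν : ∀ ω, E ω → Measure X} (h : IsSplitPoisson P lam D ν) {m : ℕ} {g : (Fin m → X) → ℝ}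
    (hg : g =ᵐ[Measure.pi fun _ => lam] 0) : ∀ᵐ ω ∂P, splitIntegral lam (ν ω) g = 0 := by
  have hJ : ∀ᵐ ω ∂P, ∀ J, g =ᵐ[mixedFactorial lam (ν ω) J] 0 := by
    refine ae_all_iff.2 fun J => ?_
    rw [← h.bind_mixedFactorial J] at hg
    exact Measure.ae_ae_of_ae_bind (h.measurable_mixedFactorial J).aemeasurable hg
  filter_upwards [hJ] with ω hω
  refine Finset.sum_eq_zero fun J _ => ?_
  rw [integral_eq_zero_of_ae (hω J), mul_zero]

end Main

end PoissonChaos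

open PoissonChaos in
open scoped Classical in
theorem mainTheorem1 {Ω X : Type*} [MeasurableSpace Ω] [MeasurableSpace X]
    (P : Measure Ω) [IsProbabilityMeasure P] (lam : Measure X) [SigmaFinite lam]
    (η : Ω → Measure X) (hη : IsPoissonProcess η lam P)
    (ℓ : ℕ) (hℓ : 1 ≤ ℓ) (n : Fin ℓ → ℕ) (hn : ∀ i, 1 ≤ n i)
    (f : ∀ i, (Fin (n i) → X) → ℝ) (hf : ∀ i, IsL1Symm lam (f i))
    (hass : ∀ σ : RowPartition n, IsNonFlat σ →
      ∫⁻ y, ENNReal.ofReal (collapse σ (tensor fun i x => |f i x|) y) ∂(blockMeasure lam σ) < ∞) :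
    -- the product is integrable, and its expectation is given by the moment formula
    (Integrable (fun ω => ∏ i, wienerIto lam (f i) (η ω)) P ∧
      ∫ ω, ∏ i, wienerIto lam (f i) (η ω) ∂P =
        ∑ σ : RowPartition n with IsNonFlatTwo σ,
          ∫ y, collapse σ (tensor f) y ∂(blockMeasure lam σ)) ∧
    -- all products of subfamilies are integrable, so that the joint cumulant is well defined
    -- (if some `f i` vanishes almost everywhere, then the cumulant formula reads `0 = 0`)
    ((∀ i, ¬ f i =ᵐ[Measure.pi fun _ : Fin (n i) => lam] 0) →
      ∀ S : Finset (Fin ℓ), Integrable (fun ω => ∏ i ∈ S, wienerIto lam (f i) (η ω)) P) ∧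
    -- the cumulant formula
    jointCumulant P (fun i ω => wienerIto lam (f i) (η ω)) =
      ((∑ σ : RowPartition n with IsConnectedNonFlatTwo σ,
          ∫ y, collapse σ (tensor f) y ∂(blockMeasure lam σ) : ℝ) : ℂ) := by
  obtain ⟨D, E, ν, h, hae⟩ := exists_isSplitPoisson hη
  have hfm : ∀ i, Measurable (f i) := fun i => (hf i).measurable
  have hW : ∀ᵐ ω ∂P, ∀ i, wienerIto lam (f i) (η ω) = splitIntegral lam (ν ω) (f i) := by
    filter_upwards [hae, ae_all_iff.2 fun i => h.ae_wienerIto_eq (hf i)] with ω hω h2 i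
    rw [hω, h2 i]
  have hd : ∀ σ : Setoid (Cell n), NonFlat σ → DiagramIntegrable lam f σ := by
    intro σ hσ
    obtain ⟨τ, rfl⟩ := partitionSetoid_bijective.2 σ
    exact diagramIntegrable_partitionSetoid hfm (hass τ (nonFlat_partitionSetoid.1 hσ))
  have hsum : ∀ (p : RowPartition n → Prop) (q : Setoid (Cell n) → Prop),
      (∀ σ, q (partitionSetoid σ) ↔ p σ) →
      ∑ σ : RowPartition n with p σ, ∫ y, collapse σ (tensor f) y ∂(blockMeasure lam σ) =
        ∑ σ : Setoid (Cell n) with q σ, diagramIntegral lam f σ := by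
    intro p q hpq
    rw [Finset.sum_filter, Finset.sum_filter]
    refine Fintype.sum_bijective _ partitionSetoid_bijective _ _ fun σ => ?_
    rw [integral_collapse hfm]
    exact if_congr (hpq σ).symm rfl rfl
  have hconn : ∀ σ : RowPartition n, (NonFlatTwo (partitionSetoid σ) ∧
      RowConnected (partitionSetoid σ)) ↔ IsConnectedNonFlatTwo σ := fun σ =>
    and_congr nonFlatTwo_partitionSetoid (rowConnected_partitionSetoid hℓ)
  -- the moment formula for subfamilies
  have hsub : (∀ i, ¬ f i =ᵐ[Measure.pi fun _ : Fin (n i) => lam] 0) → ∀ S : Finset (Fin ℓ),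
      Integrable (fun ω => ∏ i ∈ S, wienerIto lam (f i) (η ω)) P ∧
      ∫ ω, ∏ i ∈ S, wienerIto lam (f i) (η ω) ∂P = diagramMoment lam f S := by
    intro h0 S
    have hab : Function.Bijective (Sum.elim (Subtype.val : S → Fin ℓ)
        (Subtype.val : {i // i ∉ S} → Fin ℓ)) := by
      refine ⟨Subtype.val_injective.sumElim Subtype.val_injective
        fun i k hik => k.2 (hik ▸ i.2), fun i => ?_⟩
      by_cases hi : i ∈ S
      exacts [⟨Sum.inl ⟨i, hi⟩, rfl⟩, ⟨Sum.inr ⟨i, hi⟩, rfl⟩]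
    have hm := h.integral_prod_splitIntegral (f := fun i : S => f i) (fun i => hfm i)
      fun σ hσ => diagramIntegrable_of_glue hab hfm h0 hd hσ
    have hae' : (fun ω => ∏ i : S, splitIntegral lam (ν ω) (f i)) =ᵐ[P]
        fun ω => ∏ i ∈ S, wienerIto lam (f i) (η ω) := by
      filter_upwards [hW] with ω hω
      exact (Finset.prod_congr rfl fun (i : S) _ => (hω i).symm).trans
        (Finset.prod_coe_sort S fun i => wienerIto lam (f i) (η ω))
    refine ⟨hm.1.congr hae', ?_⟩
    rw [← integral_congr_ae hae', hm.2]
    rfl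
  refine ⟨?_, fun h0 S => (hsub h0 S).1, ?_⟩
  · have hm := h.integral_prod_splitIntegral hfm hd
    have hae' : (fun ω => ∏ i, splitIntegral lam (ν ω) (f i)) =ᵐ[P]
        fun ω => ∏ i, wienerIto lam (f i) (η ω) := by
      filter_upwards [hW] with ω hω
      exact Finset.prod_congr rfl fun i _ => (hω i).symm
    refine ⟨hm.1.congr hae', ?_⟩
    rw [← integral_congr_ae hae', hm.2, hsum IsNonFlatTwo NonFlatTwo
      fun σ => nonFlatTwo_partitionSetoid]
  · rw [hsum IsConnectedNonFlatTwo (fun σ => NonFlatTwo σ ∧ RowConnected σ) hconn]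
    by_cases h0 : ∀ i, ¬ f i =ᵐ[Measure.pi fun _ : Fin (n i) => lam] 0
    · obtain ⟨ℓ, rfl⟩ : ∃ k, ℓ = k + 1 := ⟨ℓ - 1, by omega⟩
      rw [jointCumulant_eq_of_recursion (C := diagramCumulant lam f) (fun S => (hsub h0 S).1) ?_,
        diagramCumulant_univ hfm]
      · congr!
      · intro S hS
        simp_rw [fun S => (hsub h0 S).2]
        convert diagramMoment_eq_sum (lam := lam) hfm hS
    · push Not at h0
      obtain ⟨i, hi⟩ := h0
      rw [jointCumulant_eq_zero (i := i), Finset.sum_eq_zero, Complex.ofReal_zero]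
      · intro σ hσ
        simp only [Finset.mem_filter, Finset.mem_univ, true_and] at hσ
        exact diagramIntegral_eq_zero hi hσ.1.1
      · filter_upwards [hW, h.ae_splitIntegral_eq_zero hi] with ω hω h2
        rw [hω i, h2]
        rfl
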